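/- A pairing function without cycles on a nonempty set $M$ is a pair of maps $l, r : M \to M$ such that $x \mapsto (l(x), r(x))$ is a bijection $M \to M^2$ and such that no composition of one or more of the maps $l, r$ has a fixed point. Let $M$ be a nonempty set with a pairing function without cycles, i.e. a model of the theory of pairing functions without cycles in the first-order language $\{l, r\}$. Let $K_0(M)$ be the Grothendieck ring of the structure $M$. That is, consider the definable subsets (with parameters) of the finite Cartesian powers $M^n$, $n \ge 0$, up to definable bijection; they form a commutative semiring with addition induced by the disjoint union and multiplication induced by the Cartesian product, and $K_0(M)$ is the ring of formal differences of elements of this semiring (equivalently, the smallest ring containing its quotient by the relation: $a \sim b$ if $a + c = b + c$ for some $c$). Write $[A]$ for the class of a definable set $A$ in $K_0(M)$. Then the unital ring homomorphism $\mathbb{Z}[X] \to K_0(M)$ sending $X$ to $[M]$ factors through an isomorphism $$\mathbb{Z}[X]/(X - X^2) \;\cong\; K_0(M).$$ In particular, $K_0(M)$ is isomorphic as a ring to $\mathbb{Z}^2$. -/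

import Mathlib

open FirstOrder
open scoped Polynomial

/-! ### The Grothendieck ring of a first-order structure -/

namespace FirstOrder.Language

universe u v w

section Objects

variable (L : Language.{u, v}) (M : Type w) [L.Structure M]

/-- An element of `Def(M)`: a subset of some finite Cartesian power of `M` that is definable in the
language `L` with parameters from `M`. -/
structure DefSet where
  /-- the exponent of the Cartesian power of `M` -/
  dim : ℕ
  /-- the underlying subset of `M ^ dim` -/
  carrier : Set (Fin dim → M)
  definable : (Set.univ : Set M).Definable L carrier

end Objects

namespace DefSet

variable {L : Language.{u, v}} {M : Type w} [L.Structure M]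

/-- A map between definable sets is definable if its graph is definable (with parameters). -/
def IsDefinableMap (A B : DefSet L M) (f : A.carrier → B.carrier) : Prop :=
  (Set.univ : Set M).Definable L
    {p : Fin A.dim ⊕ Fin B.dim → M | ∃ x : A.carrier, p ∘ Sum.inl = x.1 ∧ p ∘ Sum.inr = (f x).1}

/-- Two definable sets are equivalent if there is a definable bijection between them. -/
def Equivalent (A B : DefSet L M) : Prop :=
  ∃ f : A.carrier ≃ B.carrier, IsDefinableMap A B f

section Definability

variable {α β : Type*}

theorem definable_eq_coord (i j : α) :
    (Set.univ : Set M).Definable L {p : α → M | p i = p j} :=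
  ⟨(Term.var i).equal (Term.var j), by ext; simp⟩

theorem definable_eq_const (i : α) (c : M) :
    (Set.univ : Set M).Definable L {p : α → M | p i = c} :=
  ⟨(Term.var i).equal (L.con (⟨c, trivial⟩ : ↑(Set.univ : Set M))).term, by ext; simp⟩

theorem definable_forall [Finite β] {s : β → Set (α → M)}
    (h : ∀ i, (Set.univ : Set M).Definable L (s i)) :
    (Set.univ : Set M).Definable L {p : α → M | ∀ i, p ∈ s i} := by
  have := Set.definable_iInter_of_finite h
  convert! this using 1
  ext; simp

theorem definable_eq_coord_or_const (i : α) (c : α ⊕ M) :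
    (Set.univ : Set M).Definable L {p : α → M | p i = Sum.elim p id c} := by
  cases c with
  | inl j => exact definable_eq_coord i j
  | inr c => exact definable_eq_const i c

end Definability

variable {A B C D : DefSet L M}

/-- A map each of whose coordinates is a coordinate of the argument or a constant is definable. -/
theorem IsDefinableMap.of_coord (f : A.carrier → B.carrier) (g : Fin B.dim → Fin A.dim ⊕ M)
    (h : ∀ x j, (f x).1 j = Sum.elim x.1 id (g j)) : IsDefinableMap A B f := by
  have h1 : (Set.univ : Set M).Definable L
      {p : Fin A.dim ⊕ Fin B.dim → M | p ∘ Sum.inl ∈ A.carrier} :=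
    A.definable.preimage_comp Sum.inl
  have h2 : (Set.univ : Set M).Definable L
      {p : Fin A.dim ⊕ Fin B.dim → M | ∀ j, p ∈ {p : Fin A.dim ⊕ Fin B.dim → M |
        p (Sum.inr j) = Sum.elim p id ((g j).map Sum.inl id)}} :=
    definable_forall fun j => definable_eq_coord_or_const _ _
  unfold IsDefinableMap
  convert! h1.inter h2 using 1
  ext p
  simp only [Set.mem_ofPred_eq, Set.mem_inter_iff]
  have key : ∀ j, Sum.elim p id ((g j).map Sum.inl id) = Sum.elim (p ∘ Sum.inl) id (g j) := by
    intro j; cases g j <;> rfl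
  constructor
  · rintro ⟨x, hx, hy⟩
    refine ⟨hx ▸ x.2, fun j => ?_⟩
    rw [key, hx, ← h, ← hy]; rfl
  · rintro ⟨hx, hy⟩
    refine ⟨⟨_, hx⟩, rfl, funext fun j => ?_⟩
    rw [h, ← key, ← hy]; rfl

theorem IsDefinableMap.id (A : DefSet L M) : IsDefinableMap A A id :=
  .of_coord _ Sum.inl fun _ _ => rfl

theorem IsDefinableMap.comp {g : B.carrier → C.carrier} {f : A.carrier → B.carrier}
    (hg : IsDefinableMap B C g) (hf : IsDefinableMap A B f) : IsDefinableMap A C (g ∘ f) := by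
  have h1 := hf.preimage_comp (fun i => (Sum.elim (fun i => Sum.inl (Sum.inl i)) Sum.inr i :
    (Fin A.dim ⊕ Fin C.dim) ⊕ Fin B.dim))
  have h2 := hg.preimage_comp (fun i => (Sum.elim Sum.inr (fun i => Sum.inl (Sum.inr i)) i :
    (Fin A.dim ⊕ Fin C.dim) ⊕ Fin B.dim))
  unfold IsDefinableMap
  convert! (h1.inter h2).exists_of_finite using 1
  ext p
  constructor
  · rintro ⟨x, hx, hy⟩
    exact ⟨(f x).1, ⟨x, hx, rfl⟩, ⟨f x, rfl, hy⟩⟩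
  · rintro ⟨u, ⟨x, hx, hu⟩, ⟨y, hu', hy⟩⟩
    have : f x = y := Subtype.ext (hu.symm.trans hu')
    exact ⟨x, hx, by rw [Function.comp_apply, this]; exact hy⟩

theorem IsDefinableMap.symm {f : A.carrier ≃ B.carrier} (hf : IsDefinableMap A B f) :
    IsDefinableMap B A f.symm := by
  unfold IsDefinableMap
  convert! hf.preimage_comp Sum.swap using 1
  ext p
  constructor
  · rintro ⟨x, hx, hy⟩
    exact ⟨f.symm x, hy, hx.trans (congrArg Subtype.val (f.apply_symm_apply x).symm)⟩
  · rintro ⟨x, hx, hy⟩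
    exact ⟨f x, hy, hx.trans (congrArg Subtype.val (f.symm_apply_apply x).symm)⟩

theorem Equivalent.refl (A : DefSet L M) : Equivalent A A :=
  ⟨_root_.Equiv.refl _, .id A⟩

theorem Equivalent.symm (h : Equivalent A B) : Equivalent B A := by
  obtain ⟨f, hf⟩ := h
  exact ⟨f.symm, hf.symm⟩

theorem Equivalent.trans (h : Equivalent A B) (h' : Equivalent B C) : Equivalent A C := by
  obtain ⟨f, hf⟩ := h
  obtain ⟨g, hg⟩ := h'
  exact ⟨f.trans g, hg.comp hf⟩

instance setoid : Setoid (DefSet L M) where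
  r := Equivalent
  iseqv := ⟨.refl, .symm, .trans⟩

/-- The empty set. -/
def empty : DefSet L M := ⟨0, ∅, Set.definable_empty⟩

/-- The Cartesian power `M ^ n`. -/
def power (L : Language.{u, v}) (M : Type w) [L.Structure M] (n : ℕ) : DefSet L M :=
  ⟨n, Set.univ, Set.definable_univ⟩

/-! #### Cartesian products -/

/-- The Cartesian product `A × B ⊆ M ^ (m + n)` of `A ⊆ M ^ m` and `B ⊆ M ^ n`. -/
def prod (A B : DefSet L M) : DefSet L M where
  dim := A.dim + B.dim
  carrier := {p | p ∘ Fin.castAdd B.dim ∈ A.carrier ∧ p ∘ Fin.natAdd A.dim ∈ B.carrier}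
  definable := (A.definable.preimage_comp _).inter (B.definable.preimage_comp _)

def prodEquiv (A B : DefSet L M) : (prod A B).carrier ≃ A.carrier × B.carrier where
  toFun p := (⟨_, p.2.1⟩, ⟨_, p.2.2⟩)
  invFun x := ⟨Fin.append x.1.1 x.2.1, by
    constructor
    · convert! x.1.2 using 1
      ext i; simp
    · convert! x.2.2 using 1
      ext i; simp⟩
  left_inv p := by
    apply Subtype.ext
    funext i
    refine Fin.addCases (fun i => ?_) (fun i => ?_) i
    · exact Fin.append_left _ _ i
    · exact Fin.append_right _ _ i
  right_inv x := by
    refine Prod.ext (Subtype.ext ?_) (Subtype.ext ?_) <;> · ext i; simp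

theorem isDefinableMap_fst : IsDefinableMap (prod A B) A fun p => (prodEquiv A B p).1 :=
  .of_coord _ (fun i => Sum.inl (Fin.castAdd B.dim i)) fun _ _ => rfl

theorem isDefinableMap_snd : IsDefinableMap (prod A B) B fun p => (prodEquiv A B p).2 :=
  .of_coord _ (fun i => Sum.inl (Fin.natAdd A.dim i)) fun _ _ => rfl

theorem isDefinableMap_pair {f : C.carrier → A.carrier} {g : C.carrier → B.carrier}
    (hf : IsDefinableMap C A f) (hg : IsDefinableMap C B g) :
    IsDefinableMap C (prod A B) fun x => (prodEquiv A B).symm (f x, g x) := by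
  have h1 := hf.preimage_comp (Sum.map _root_.id (Fin.castAdd B.dim))
  have h2 := hg.preimage_comp (Sum.map _root_.id (Fin.natAdd A.dim))
  unfold IsDefinableMap
  convert! h1.inter h2 using 1
  ext p
  constructor
  · rintro ⟨x, hx, hy⟩
    refine ⟨⟨x, hx, ?_⟩, ⟨x, hx, ?_⟩⟩
    · funext i
      have := congrFun hy (Fin.castAdd B.dim i)
      simpa [prodEquiv] using! this
    · funext i
      have := congrFun hy (Fin.natAdd A.dim i)
      simpa [prodEquiv] using! this
  · rintro ⟨⟨x, hx, hy⟩, ⟨x', hx', hy'⟩⟩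
    have : x = x' := Subtype.ext (hx.symm.trans hx')
    subst this
    refine ⟨x, hx, ?_⟩
    funext i
    refine Fin.addCases (fun i => ?_) (fun i => ?_) i
    · have := congrFun hy i
      simpa [prodEquiv] using! this
    · have := congrFun hy' i
      simpa [prodEquiv] using! this

/-- A map into a product is definable as soon as its two components are. -/
theorem isDefinableMap_to_prod {f : C.carrier → (prod A B).carrier}
    (h1 : IsDefinableMap C A fun x => (prodEquiv A B (f x)).1)
    (h2 : IsDefinableMap C B fun x => (prodEquiv A B (f x)).2) :
    IsDefinableMap C (prod A B) f := by
  convert! isDefinableMap_pair h1 h2 using 1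
  funext x
  simp

theorem prod_congr (h : Equivalent A B) (h' : Equivalent C D) :
    Equivalent (prod A C) (prod B D) := by
  obtain ⟨f, hf⟩ := h
  obtain ⟨g, hg⟩ := h'
  refine ⟨(prodEquiv A C).trans ((Equiv.prodCongr f g).trans (prodEquiv B D).symm),
    isDefinableMap_to_prod ?_ ?_⟩
  · simpa using! hf.comp isDefinableMap_fst
  · simpa using! hg.comp isDefinableMap_snd

theorem prod_comm_equiv (A B : DefSet L M) : Equivalent (prod A B) (prod B A) := by
  refine ⟨(prodEquiv A B).trans ((Equiv.prodComm _ _).trans (prodEquiv B A).symm),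
    isDefinableMap_to_prod ?_ ?_⟩
  · simpa using! isDefinableMap_snd
  · simpa using! isDefinableMap_fst

theorem prod_assoc_equiv (A B C : DefSet L M) :
    Equivalent (prod (prod A B) C) (prod A (prod B C)) := by
  refine ⟨(prodEquiv _ _).trans <| (Equiv.prodCongr (prodEquiv _ _)
      (_root_.Equiv.refl _)).trans <| (Equiv.prodAssoc _ _ _).trans <|
      (Equiv.prodCongr (_root_.Equiv.refl _) (prodEquiv _ _).symm).trans (prodEquiv _ _).symm,
    isDefinableMap_to_prod ?_ (isDefinableMap_to_prod ?_ ?_)⟩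
  · simpa using! isDefinableMap_fst.comp isDefinableMap_fst
  · simpa using! isDefinableMap_snd.comp isDefinableMap_fst
  · simpa using! isDefinableMap_snd

instance : Unique (power L M 0).carrier where
  default := ⟨Fin.elim0, trivial⟩
  uniq _ := Subtype.ext (funext fun i => i.elim0)

theorem point_prod_equiv (A : DefSet L M) : Equivalent (prod (power L M 0) A) A := by
  refine ⟨(prodEquiv _ _).trans (Equiv.uniqueProd _ _), ?_⟩
  simpa using! isDefinableMap_snd

theorem empty_prod_equiv (A : DefSet L M) : Equivalent (prod empty A) empty :=
  ⟨⟨fun p => (prodEquiv _ _ p).1, fun p => p.2.elim,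
    fun p => (prodEquiv _ _ p).1.2.elim, fun p => p.2.elim⟩, isDefinableMap_fst⟩

instance : IsEmpty (empty : DefSet L M).carrier := ⟨fun x => x.2⟩

theorem isDefinableMap_of_isEmpty [IsEmpty A.carrier] (f : A.carrier → B.carrier) :
    IsDefinableMap A B f := by
  unfold IsDefinableMap
  convert! Set.definable_empty using 1
  ext p
  simp

/-! #### Disjoint unions -/

section Sum

variable [Nontrivial M]

variable (M) in
/-- Two distinct elements of `M`, used to make two definable sets disjoint. -/
noncomputable def tag (b : Bool) : M :=
  bif b then (exists_pair_ne M).choose_spec.choose else (exists_pair_ne M).choose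

theorem tag_ne : tag M false ≠ tag M true := (exists_pair_ne M).choose_spec.choose_spec

/-- The disjoint union of `A ⊆ M ^ m` and `B ⊆ M ^ n`, realized in `M ^ (m + n + 1)`: with the
distinct elements `a = tag M false` and `b = tag M true` of `M` it is
`A × {(a, …, a)} × {a} ∪ {(a, …, a)} × B × {b}`. -/
noncomputable def sum (A B : DefSet L M) : DefSet L M where
  dim := A.dim + B.dim + 1
  carrier :=
    {p | p (Fin.last _) = tag M false ∧
        (fun i : Fin A.dim => p (Fin.castSucc (Fin.castAdd B.dim i))) ∈ A.carrier ∧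
        ∀ j : Fin B.dim, p (Fin.castSucc (Fin.natAdd A.dim j)) = tag M false} ∪
    {p | p (Fin.last _) = tag M true ∧
        (fun j : Fin B.dim => p (Fin.castSucc (Fin.natAdd A.dim j))) ∈ B.carrier ∧
        ∀ i : Fin A.dim, p (Fin.castSucc (Fin.castAdd B.dim i)) = tag M false}
  definable :=
    ((definable_eq_const _ _).inter <| (A.definable.preimage_comp _).inter <|
      definable_forall fun _ => definable_eq_const _ _).union
    ((definable_eq_const _ _).inter <| (B.definable.preimage_comp _).inter <|
      definable_forall fun _ => definable_eq_const _ _)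

noncomputable def inl (A B : DefSet L M) (x : A.carrier) : (sum A B).carrier :=
  ⟨Fin.snoc (α := fun _ => M) (Fin.append x.1 fun _ => tag M false) (tag M false),
    Or.inl (by simp [-Fin.castSucc_natAdd])⟩

noncomputable def inr (A B : DefSet L M) (y : B.carrier) : (sum A B).carrier :=
  ⟨Fin.snoc (α := fun _ => M) (Fin.append (fun _ => tag M false) y.1) (tag M true),
    Or.inr (by simp [-Fin.castSucc_natAdd])⟩

theorem sumElim_bijective (A B : DefSet L M) :
    Function.Bijective (Sum.elim (inl A B) (inr A B)) := by
  constructor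
  · rintro (x | x) (y | y) h
    · have h' := congrArg Subtype.val h
      congr 1
      apply Subtype.ext
      funext i
      have := congrFun h' (Fin.castSucc (Fin.castAdd B.dim i))
      simpa [-Fin.castSucc_natAdd, inl] using this
    · have := congrFun (congrArg Subtype.val h) (Fin.last _)
      simp [-Fin.castSucc_natAdd, inl, inr, tag_ne] at this
    · have := congrFun (congrArg Subtype.val h) (Fin.last _)
      simp [-Fin.castSucc_natAdd, inl, inr, tag_ne.symm] at this
    · have h' := congrArg Subtype.val h
      congr 1
      apply Subtype.ext
      funext i
      have := congrFun h' (Fin.castSucc (Fin.natAdd A.dim i))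
      simpa [-Fin.castSucc_natAdd, inr] using this
  · rintro ⟨p, ⟨h1, h2, h3⟩ | ⟨h1, h2, h3⟩⟩
    · refine ⟨Sum.inl ⟨_, h2⟩, Subtype.ext (funext fun i => ?_)⟩
      refine Fin.lastCases ?_ (fun i => Fin.addCases (fun i => ?_) (fun i => ?_) i) i
      · simp [-Fin.castSucc_natAdd, inl, h1]
      · simp [-Fin.castSucc_natAdd, inl]
      · simp [-Fin.castSucc_natAdd, inl, h3]
    · refine ⟨Sum.inr ⟨_, h2⟩, Subtype.ext (funext fun i => ?_)⟩
      refine Fin.lastCases ?_ (fun i => Fin.addCases (fun i => ?_) (fun i => ?_) i) i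
      · simp [-Fin.castSucc_natAdd, inr, h1]
      · simp [-Fin.castSucc_natAdd, inr, h3]
      · simp [-Fin.castSucc_natAdd, inr]

noncomputable def sumEquiv (A B : DefSet L M) : A.carrier ⊕ B.carrier ≃ (sum A B).carrier :=
  Equiv.ofBijective _ (sumElim_bijective A B)

theorem isDefinableMap_inl :
    IsDefinableMap A (sum A B) fun x => sumEquiv A B (Sum.inl x) := by
  refine .of_coord _ (Fin.snoc (α := fun _ => Fin A.dim ⊕ M)
    (Fin.append Sum.inl fun _ => Sum.inr (tag M false)) (Sum.inr (tag M false))) fun x i => ?_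
  refine Fin.lastCases ?_ (fun i => Fin.addCases (fun i => ?_) (fun i => ?_) i) i <;>
    simp [-Fin.castSucc_natAdd, sumEquiv, inl]

theorem isDefinableMap_inr :
    IsDefinableMap B (sum A B) fun x => sumEquiv A B (Sum.inr x) := by
  refine .of_coord _ (Fin.snoc (α := fun _ => Fin B.dim ⊕ M)
    (Fin.append (fun _ => Sum.inr (tag M false)) Sum.inl) (Sum.inr (tag M true))) fun x i => ?_
  refine Fin.lastCases ?_ (fun i => Fin.addCases (fun i => ?_) (fun i => ?_) i) i <;>
    simp [-Fin.castSucc_natAdd, sumEquiv, inr]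

/-- A map out of a disjoint union is definable as soon as its two restrictions are. -/
theorem isDefinableMap_from_sum {f : (sum A B).carrier → C.carrier}
    (h1 : IsDefinableMap A C fun x => f (sumEquiv A B (Sum.inl x)))
    (h2 : IsDefinableMap B C fun x => f (sumEquiv A B (Sum.inr x))) :
    IsDefinableMap (sum A B) C f := by
  have a1 := (isDefinableMap_inl (A := A) (B := B)).preimage_comp
    (Sum.elim Sum.inr (fun i => Sum.inl (Sum.inl i)) :
      _ → (Fin (sum A B).dim ⊕ Fin C.dim) ⊕ Fin A.dim)
  have a2 := h1.preimage_comp (Sum.elim Sum.inr (fun i => Sum.inl (Sum.inr i)) :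
      _ → (Fin (sum A B).dim ⊕ Fin C.dim) ⊕ Fin A.dim)
  have b1 := (isDefinableMap_inr (A := A) (B := B)).preimage_comp
    (Sum.elim Sum.inr (fun i => Sum.inl (Sum.inl i)) :
      _ → (Fin (sum A B).dim ⊕ Fin C.dim) ⊕ Fin B.dim)
  have b2 := h2.preimage_comp (Sum.elim Sum.inr (fun i => Sum.inl (Sum.inr i)) :
      _ → (Fin (sum A B).dim ⊕ Fin C.dim) ⊕ Fin B.dim)
  unfold IsDefinableMap
  convert! ((a1.inter a2).exists_of_finite).union ((b1.inter b2).exists_of_finite) using 1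
  ext p
  constructor
  · rintro ⟨z, hz, hy⟩
    obtain ⟨x | x, rfl⟩ := (sumEquiv A B).surjective z
    · exact Or.inl ⟨x.1, ⟨x, rfl, hz⟩, ⟨x, rfl, hy⟩⟩
    · exact Or.inr ⟨x.1, ⟨x, rfl, hz⟩, ⟨x, rfl, hy⟩⟩
  · rintro (⟨u, ⟨x, hx, hz⟩, ⟨x', hx', hy⟩⟩ | ⟨u, ⟨x, hx, hz⟩, ⟨x', hx', hy⟩⟩)
    · obtain rfl : x = x' := Subtype.ext (hx.symm.trans hx')
      exact ⟨_, hz, hy⟩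
    · obtain rfl : x = x' := Subtype.ext (hx.symm.trans hx')
      exact ⟨_, hz, hy⟩

/-! #### Compatibility with definable bijections, and the laws of a commutative semiring -/

theorem sum_congr (h : Equivalent A B) (h' : Equivalent C D) :
    Equivalent (sum A C) (sum B D) := by
  obtain ⟨f, hf⟩ := h
  obtain ⟨g, hg⟩ := h'
  refine ⟨(sumEquiv A C).symm.trans ((Equiv.sumCongr f g).trans (sumEquiv B D)),
    isDefinableMap_from_sum ?_ ?_⟩
  · simpa using! isDefinableMap_inl.comp hf
  · simpa using! isDefinableMap_inr.comp hg

theorem sum_comm_equiv (A B : DefSet L M) : Equivalent (sum A B) (sum B A) := by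
  refine ⟨(sumEquiv A B).symm.trans ((Equiv.sumComm _ _).trans (sumEquiv B A)),
    isDefinableMap_from_sum ?_ ?_⟩
  · simpa using! isDefinableMap_inr
  · simpa using! isDefinableMap_inl

theorem sum_assoc_equiv (A B C : DefSet L M) :
    Equivalent (sum (sum A B) C) (sum A (sum B C)) := by
  refine ⟨(sumEquiv _ _).symm.trans <| (Equiv.sumCongr (sumEquiv _ _).symm
      (_root_.Equiv.refl _)).trans <| (Equiv.sumAssoc _ _ _).trans <|
      (Equiv.sumCongr (_root_.Equiv.refl _) (sumEquiv _ _)).trans (sumEquiv _ _),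
    isDefinableMap_from_sum (isDefinableMap_from_sum ?_ ?_) ?_⟩
  · simpa using! isDefinableMap_inl
  · simpa using! isDefinableMap_inr.comp isDefinableMap_inl
  · simpa using! isDefinableMap_inr.comp isDefinableMap_inr

theorem empty_sum_equiv (A : DefSet L M) : Equivalent (sum empty A) A := by
  refine ⟨(sumEquiv _ _).symm.trans (Equiv.emptySum _ _),
    isDefinableMap_from_sum (isDefinableMap_of_isEmpty _) ?_⟩
  simpa using! IsDefinableMap.id A

/-- Distributivity of the Cartesian product over the disjoint union. -/
theorem sum_prod_equiv (A B C : DefSet L M) :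
    Equivalent (sum (prod A B) (prod A C)) (prod A (sum B C)) := by
  refine ⟨(sumEquiv _ _).symm.trans <| (Equiv.sumCongr (prodEquiv _ _) (prodEquiv _ _)).trans <|
      (Equiv.prodSumDistrib _ _ _).symm.trans <|
      (Equiv.prodCongr (_root_.Equiv.refl _) (sumEquiv _ _)).trans (prodEquiv _ _).symm,
    isDefinableMap_from_sum (isDefinableMap_to_prod ?_ ?_) (isDefinableMap_to_prod ?_ ?_)⟩
  · simpa using! isDefinableMap_fst
  · simpa using! isDefinableMap_inl.comp isDefinableMap_snd
  · simpa using! isDefinableMap_fst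
  · simpa using! isDefinableMap_inr.comp isDefinableMap_snd

end Sum

end DefSet

/-! #### The semiring of definable sets up to definable bijection -/

/-- The definable sets of `M` up to definable bijection (the Grothendieck semiring of `M`). -/
def DefClass (L : Language.{u, v}) (M : Type w) [L.Structure M] : Type w :=
  Quotient (DefSet.setoid (L := L) (M := M))

namespace DefClass

variable {L : Language.{u, v}} {M : Type w} [L.Structure M]

/-- The class of a definable set up to definable bijection. -/
def mk (A : DefSet L M) : DefClass L M := Quotient.mk _ A

theorem mk_eq_mk {A B : DefSet L M} : mk A = mk B ↔ DefSet.Equivalent A B :=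
  Quotient.eq

theorem ind {p : DefClass L M → Prop} (h : ∀ A, p (mk A)) (x : DefClass L M) : p x :=
  Quotient.ind h x

/-- Multiplication is induced by the Cartesian product. -/
instance : Mul (DefClass L M) :=
  ⟨Quotient.map₂ DefSet.prod fun _ _ h _ _ h' => DefSet.prod_congr h h'⟩

/-- `0` is the class of the empty set. -/
instance : Zero (DefClass L M) := ⟨mk DefSet.empty⟩

/-- `1` is the class of a point, namely of `M ^ 0`. -/
instance : One (DefClass L M) := ⟨mk (DefSet.power L M 0)⟩

theorem mk_prod (A B : DefSet L M) : mk (A.prod B) = mk A * mk B := rfl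

theorem mk_empty : mk (DefSet.empty : DefSet L M) = 0 := rfl

theorem mk_point : mk (DefSet.power L M 0) = 1 := rfl

variable [Nontrivial M]

/-- Addition is induced by the disjoint union. -/
noncomputable instance : Add (DefClass L M) :=
  ⟨Quotient.map₂ DefSet.sum fun _ _ h _ _ h' => DefSet.sum_congr h h'⟩

noncomputable instance : CommSemiring (DefClass L M) where
  nsmul := nsmulRec
  add_assoc := by
    refine ind fun A => ind fun B => ind fun C => ?_
    exact mk_eq_mk.2 (DefSet.sum_assoc_equiv A B C)
  add_comm := by
    refine ind fun A => ind fun B => ?_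
    exact mk_eq_mk.2 (DefSet.sum_comm_equiv A B)
  zero_add := ind fun A => mk_eq_mk.2 (DefSet.empty_sum_equiv A)
  add_zero := ind fun A =>
    mk_eq_mk.2 ((DefSet.sum_comm_equiv A _).trans (DefSet.empty_sum_equiv A))
  mul_assoc := by
    refine ind fun A => ind fun B => ind fun C => ?_
    exact mk_eq_mk.2 (DefSet.prod_assoc_equiv A B C)
  mul_comm := by
    refine ind fun A => ind fun B => ?_
    exact mk_eq_mk.2 (DefSet.prod_comm_equiv A B)
  one_mul := ind fun A => mk_eq_mk.2 (DefSet.point_prod_equiv A)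
  mul_one := ind fun A =>
    mk_eq_mk.2 ((DefSet.prod_comm_equiv A _).trans (DefSet.point_prod_equiv A))
  zero_mul := ind fun A => mk_eq_mk.2 (DefSet.empty_prod_equiv A)
  mul_zero := ind fun A =>
    mk_eq_mk.2 ((DefSet.prod_comm_equiv A _).trans (DefSet.empty_prod_equiv A))
  left_distrib := by
    refine ind fun A => ind fun B => ind fun C => ?_
    exact mk_eq_mk.2 (DefSet.sum_prod_equiv A B C).symm
  right_distrib := by
    refine ind fun A => ind fun B => ind fun C => ?_
    refine mk_eq_mk.2 (((DefSet.prod_comm_equiv _ _).trans (DefSet.sum_prod_equiv C A B).symm).trans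
      (DefSet.sum_congr (DefSet.prod_comm_equiv _ _) (DefSet.prod_comm_equiv _ _)))

theorem mk_sum (A B : DefSet L M) : mk (A.sum B) = mk A + mk B := rfl

theorem mk_union_of_disjoint {n : ℕ} {S T : Set (Fin n → M)}
    (hS : (Set.univ : Set M).Definable L S) (hT : (Set.univ : Set M).Definable L T)
    (h : Disjoint S T) :
    mk ⟨n, S ∪ T, hS.union hT⟩ = mk ⟨n, S, hS⟩ + mk ⟨n, T, hT⟩ := by
  classical
  rw [← mk_sum, eq_comm, mk_eq_mk]
  refine ⟨(DefSet.sumEquiv _ _).symm.trans (Equiv.Set.union h).symm,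
    DefSet.isDefinableMap_from_sum (.of_coord _ Sum.inl ?_) (.of_coord _ Sum.inl ?_)⟩
  · intro x j; simp
  · intro x j; simp

/-- The additive law satisfies `[A] + [B] = [A ∪ B] + [A ∩ B]`. -/
theorem mk_union_add_mk_inter {n : ℕ} {S T : Set (Fin n → M)}
    (hS : (Set.univ : Set M).Definable L S) (hT : (Set.univ : Set M).Definable L T) :
    mk ⟨n, S ∪ T, hS.union hT⟩ + mk ⟨n, S ∩ T, hS.inter hT⟩ =
      mk ⟨n, S, hS⟩ + mk ⟨n, T, hT⟩ := by
  have h1 := mk_union_of_disjoint hS (hT.sdiff hS) Set.disjoint_sdiff_right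
  have h2 := mk_union_of_disjoint (hT.sdiff hS) (hS.inter hT)
    (Set.disjoint_left.2 fun x hx hx' => hx.2 hx'.1)
  have e1 : S ∪ T \ S = S ∪ T := Set.union_sdiff_self
  have e2 : T \ S ∪ S ∩ T = T := by ext x; simp; tauto
  simp only [e1, e2] at h1 h2
  rw [h1, h2, add_assoc]

end DefClass

end FirstOrder.Language

/-! ### The Grothendieck ring of a commutative semiring -/

/-- The Grothendieck ring of a commutative semiring `S`: the ring of formal differences `a - b` of
elements of `S`, where `a - b = c - d` if and only if `a + d + e = c + b + e` for some `e`. This is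
the smallest ring containing the quotient of `S` by the relation `∃ e, a + e = b + e`. -/
def GrothendieckRing (S : Type*) [CommSemiring S] : Type _ :=
  Algebra.GrothendieckAddGroup S

namespace GrothendieckRing

open Algebra

variable {S : Type*} [CommSemiring S]

noncomputable instance : AddCommGroup (GrothendieckRing S) :=
  inferInstanceAs (AddCommGroup (GrothendieckAddGroup S))

/-- The canonical additive map from `S` to its Grothendieck ring. -/
def ofAdd : S →+ GrothendieckRing S := GrothendieckAddGroup.of

theorem ofAdd_eq_ofAdd {a b : S} :
    (ofAdd a : GrothendieckRing S) = ofAdd b ↔ ∃ c, a + c = b + c := by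
  have h := (AddLocalization.addMonoidOf (⊤ : AddSubmonoid S)).eq_iff_exists (x := a) (y := b)
  refine h.trans ⟨fun ⟨c, hc⟩ => ⟨c, ?_⟩, fun ⟨c, hc⟩ => ⟨⟨c, trivial⟩, ?_⟩⟩
  · rw [add_comm a, add_comm b, hc]
  · rw [add_comm _ a, add_comm _ b]; exact hc

theorem exists_sub (x : GrothendieckRing S) : ∃ a b : S, x = ofAdd a - ofAdd b := by
  obtain ⟨⟨a, b⟩, h⟩ := (AddLocalization.addMonoidOf (⊤ : AddSubmonoid S)).surj x
  exact ⟨a, b, eq_sub_of_add_eq h⟩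

theorem addHom_ext {G : Type*} [AddCommGroup G] {f g : GrothendieckRing S →+ G}
    (h : ∀ a, f (ofAdd a) = g (ofAdd a)) : f = g := by
  ext x
  obtain ⟨a, b, rfl⟩ := exists_sub x
  rw [map_sub, map_sub, h, h]

/-- The additive extension to the Grothendieck ring of an additive map on `S`. -/
noncomputable def liftAdd {G : Type*} [AddCommGroup G] (f : S →+ G) : GrothendieckRing S →+ G :=
  GrothendieckAddGroup.lift f

theorem liftAdd_ofAdd {G : Type*} [AddCommGroup G] (f : S →+ G) (a : S) :
    liftAdd f (ofAdd a) = f a :=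
  DFunLike.congr_fun (GrothendieckAddGroup.lift.symm_apply_apply f) a

/-- The biadditive extension of the multiplication of `S`. -/
noncomputable def mulHom : GrothendieckRing S →+ GrothendieckRing S →+ GrothendieckRing S :=
  liftAdd
    { toFun := fun a => liftAdd (ofAdd.comp (AddMonoidHom.mulLeft a))
      map_zero' := addHom_ext fun b => by simp [liftAdd_ofAdd]
      map_add' := fun a a' => addHom_ext fun b => by simp [liftAdd_ofAdd, add_mul] }

theorem mulHom_ofAdd (a b : S) : mulHom (ofAdd a) (ofAdd b) = ofAdd (a * b) := by
  simp [mulHom, liftAdd_ofAdd]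

/-- The multiplication is determined by `(a - b) * (c - d) = (a * c + b * d) - (a * d + b * c)`. -/
noncomputable instance : CommRing (GrothendieckRing S) where
  __ := (inferInstance : AddCommGroup (GrothendieckRing S))
  mul x y := mulHom x y
  one := ofAdd 1
  left_distrib x y z := map_add (mulHom x) y z
  right_distrib x y z := by
    change mulHom (x + y) z = mulHom x z + mulHom y z
    rw [map_add, AddMonoidHom.add_apply]
  zero_mul x := by
    change mulHom 0 x = 0
    rw [map_zero, AddMonoidHom.zero_apply]
  mul_zero x := map_zero (mulHom x)
  mul_assoc x y z := by
    obtain ⟨a, b, rfl⟩ := exists_sub x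
    obtain ⟨c, d, rfl⟩ := exists_sub y
    obtain ⟨e, f, rfl⟩ := exists_sub z
    change mulHom (mulHom _ _) _ = mulHom _ (mulHom _ _)
    simp only [map_sub, AddMonoidHom.sub_apply, mulHom_ofAdd, mul_assoc]
  mul_comm x y := by
    obtain ⟨a, b, rfl⟩ := exists_sub x
    obtain ⟨c, d, rfl⟩ := exists_sub y
    change mulHom _ _ = mulHom _ _
    simp only [map_sub, AddMonoidHom.sub_apply, mulHom_ofAdd, mul_comm c, mul_comm d]
    abel
  one_mul x := by
    obtain ⟨a, b, rfl⟩ := exists_sub x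
    change mulHom (ofAdd 1) _ = _
    simp only [map_sub, mulHom_ofAdd, one_mul]
  mul_one x := by
    obtain ⟨a, b, rfl⟩ := exists_sub x
    change mulHom _ (ofAdd 1) = _
    simp only [map_sub, AddMonoidHom.sub_apply, mulHom_ofAdd, mul_one]

/-- The canonical ring homomorphism from `S` to its Grothendieck ring. -/
noncomputable def of : S →+* GrothendieckRing S where
  __ := ofAdd
  map_one' := rfl
  map_mul' a b := (mulHom_ofAdd a b).symm

theorem of_eq_of {a b : S} : (of a : GrothendieckRing S) = of b ↔ ∃ c, a + c = b + c :=
  ofAdd_eq_ofAdd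

end GrothendieckRing

/-! ### The Grothendieck ring of a structure -/

namespace FirstOrder.Language

universe u v w

/-- The Grothendieck ring `K₀(M)` of a structure `M` (with at least two elements). -/
abbrev K0 (L : Language.{u, v}) (M : Type w) [L.Structure M] [Nontrivial M] : Type w :=
  GrothendieckRing (DefClass L M)

/-- The class `[A]` of a definable set `A` in `K₀(M)`. -/
noncomputable def K0.mk {L : Language.{u, v}} {M : Type w} [L.Structure M] [Nontrivial M]
    (A : DefSet L M) : K0 L M :=
  GrothendieckRing.of (DefClass.mk A)

/-! ### Pairing functions without cycles -/

/-- The function symbols of the language of pairing functions: two unary symbols `l` and `r`. -/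
inductive PairingFunctions : ℕ → Type
  | l : PairingFunctions 1
  | r : PairingFunctions 1

/-- The language `{l, r}` of pairing functions. -/
def pairing : Language.{0, 0} := ⟨PairingFunctions, fun _ => Empty⟩

namespace pairing

def l : pairing.Functions 1 := PairingFunctions.l

def r : pairing.Functions 1 := PairingFunctions.r

/-- The term `f₁ (f₂ (… (fₖ t)))` for a word `[f₁, f₂, …, fₖ]` in the symbols `l` and `r`. -/
def wordTerm {α : Type*} (w : List (pairing.Functions 1)) (t : pairing.Term α) : pairing.Term α :=
  w.foldr (fun f t => f.apply₁ t) t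

/-- `∀ x y, l x = l y ∧ r x = r y → x = y` -/
def injAxiom : pairing.Sentence :=
  ∀' ∀' (((l.apply₁ (&0)).bdEqual (l.apply₁ (&1)) ⊓ (r.apply₁ (&0)).bdEqual (r.apply₁ (&1))) ⟹
    (&0).bdEqual (&1))

/-- `∀ y z, ∃ x, l x = y ∧ r x = z` -/
def surjAxiom : pairing.Sentence :=
  ∀' ∀' ∃' ((l.apply₁ (&2)).bdEqual (&0) ⊓ (r.apply₁ (&2)).bdEqual (&1))

/-- `∀ x, w(x) ≠ x` -/
def noCycleAxiom (w : List (pairing.Functions 1)) : pairing.Sentence :=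
  ∀' ∼((wordTerm w (&0)).bdEqual (&0))

/-- The theory of pairing functions without cycles: `x ↦ (l x, r x)` is injective and surjective,
and no composition of at least one of the functions `l` and `r` has a fixed point. -/
def theoryWithoutCycles : pairing.Theory :=
  {injAxiom, surjAxiom} ∪ {φ | ∃ w : List (pairing.Functions 1), w ≠ [] ∧ φ = noCycleAxiom w}

theorem model_iff (M : Type*) [pairing.Structure M] :
    M ⊨ theoryWithoutCycles ↔
      Function.Bijective (fun x : M => (Structure.funMap l ![x], Structure.funMap r ![x])) ∧
      ∀ w : List (pairing.Functions 1), w ≠ [] → ∀ x : M,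
        w.foldr (fun f y => Structure.funMap f ![y]) x ≠ x := by
  have hw : ∀ (w : List (pairing.Functions 1)) (x : M) (v : Empty → M),
      (wordTerm w (&0)).realize (Sum.elim v (Fin.snoc default x : Fin 1 → M)) =
        w.foldr (fun f y => Structure.funMap f ![y]) x := by
    intro w x v
    induction w with
    | nil => simp [wordTerm, Fin.snoc]
    | cons f w ih =>
      simp only [wordTerm, List.foldr_cons, Term.realize_functions_apply₁] at ih ⊢
      rw [ih]
  have h1 : M ⊨ injAxiom ↔ Function.Injective
      (fun x : M => (Structure.funMap l ![x], Structure.funMap r ![x])) := by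
    simp [injAxiom, Sentence.Realize, Formula.Realize, Function.Injective, Fin.snoc]
  have h2 : M ⊨ surjAxiom ↔ Function.Surjective
      (fun x : M => (Structure.funMap l ![x], Structure.funMap r ![x])) := by
    simp [surjAxiom, Sentence.Realize, Formula.Realize, Function.Surjective, Fin.snoc]
  have h3 : ∀ w, M ⊨ noCycleAxiom w ↔
      ∀ x : M, w.foldr (fun f y => Structure.funMap f ![y]) x ≠ x := by
    intro w
    simp only [noCycleAxiom, Sentence.Realize, Formula.Realize, BoundedFormula.realize_all,
      BoundedFormula.realize_not, BoundedFormula.realize_bdEqual, hw]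
    simp [Fin.snoc]
  rw [Theory.model_iff, Function.Bijective, ← h1, ← h2]
  constructor
  · intro h
    exact ⟨⟨h _ (by simp [theoryWithoutCycles]), h _ (by simp [theoryWithoutCycles])⟩,
      fun w hw => (h3 w).1 (h _ (Or.inr ⟨w, hw, rfl⟩))⟩
  · rintro ⟨⟨ha, hb⟩, hc⟩ φ ((rfl | rfl) | ⟨w, hw, rfl⟩)
    · exact ha
    · exact hb
    · exact (h3 w).2 (hc w hw)

/-- A model of the theory has at least two elements, since `l x ≠ x`. -/
instance nontrivial (M : Type*) [pairing.Structure M] [Nonempty M] [M ⊨ theoryWithoutCycles] :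
    Nontrivial M := by
  obtain ⟨x⟩ := ‹Nonempty M›
  exact ⟨_, x, ((model_iff M).1 inferInstance).2 [l] (by simp) x⟩

end pairing

end FirstOrder.Language

/-! ### Sets with an acyclic pairing function -/

/-! The plan is a small algebraic geometry over `M`, in which closed sets are solution sets of
finite systems of equations between words in `l`, `r` applied to coordinates, and constants.

Parametrization: after each variable is split into pairs often enough, such an equation becomes an
equation between terms built with `pair`, and unification solves it. The occurs check is justified
by acyclicity. Hence a nonempty closed set is the injective image of some `M ^ m` under a term map
(`IsClosedSet.exists_param`).

Irreducibility: acyclicity also produces elements satisfying none of finitely many nontrivial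
one-variable equations. So a line lies in a closed set or meets it thinly, and no nonempty closed
set is covered by finitely many closed sets not containing it
(`IsClosedSet.exists_mem_forall_notMem`). Both facts together give quantifier elimination:
projections of constructible sets are constructible (`IsConstructible.image`), so definable sets are
constructible.

Generation: constructible sets are obtained from closed sets by disjoint unions and proper
differences. A nonempty closed set has class `[M] ^ m`, and `pair` gives `[M] ^ 2 = [M]`, so every
class is `a + b[M]` with integers `a`, `b` (`K0_mk_eq`).

Independence: irreducibility makes the indicators of nonempty closed sets linearly independent, so
an additive invariant may be prescribed on them: `(1, 0)` on points and `(0, 1)` on larger closed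
sets. It is preserved by injective projections (`IsConstructible.euler_image`). Applied to the two
projections of a graph, this gives invariance under definable bijections. The invariant separates
`1` from `[M]`, so `a + b[M] = 0` forces `a = b = 0`. -/

/-- A pairing function without cycles: a bijection `x ↦ (l x, r x)` from `M` to `M × M`, with
inverse `pair`, such that no nonempty composition of `l` and `r` has a fixed point. -/
class AcyclicPairing (M : Type*) where
  step : Bool → M → M
  pair : M → M → M
  step_false_pair : ∀ x y, step false (pair x y) = x
  step_true_pair : ∀ x y, step true (pair x y) = y
  pair_step : ∀ x, pair (step false x) (step true x) = x
  foldl_ne : ∀ w : List Bool, w ≠ [] → ∀ x, w.foldl (fun y b => step b y) x ≠ x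

namespace AcyclicPairing

attribute [simp] step_false_pair step_true_pair pair_step

variable {M : Type*} [AcyclicPairing M] {α β : Type*}

/-- The composition of the maps `step b`, for `b` in a word, the first letter being applied
first. -/
def word (w : List Bool) (x : M) : M := w.foldl (fun y b => step b y) x

@[simp] theorem word_nil (x : M) : word [] x = x := rfl

@[simp] theorem word_cons (b : Bool) (w : List Bool) (x : M) :
    word (b :: w) x = word w (step b x) := rfl

theorem word_append (v w : List Bool) (x : M) : word (v ++ w) x = word w (word v x) :=
  List.foldl_append

theorem step_word (b : Bool) (w : List Bool) (x : M) :
    step b (word w x) = word (w ++ [b]) x := by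
  rw [word_append]; rfl

theorem word_ne {w : List Bool} (h : w ≠ []) (x : M) : word w x ≠ x := foldl_ne w h x

theorem eq_pair_iff {x y z : M} : z = pair x y ↔ step false z = x ∧ step true z = y := by
  constructor
  · rintro rfl; simp
  · rintro ⟨rfl, rfl⟩; simp

theorem infinite_of_nonempty [Nonempty M] : Infinite M := by
  obtain ⟨x⟩ := ‹Nonempty M›
  have h : ∀ m n : ℕ, word (List.replicate (m + (n + 1)) false) x ≠
      word (List.replicate m false) x := by
    intro m n
    rw [List.replicate_add, word_append]
    exact word_ne (by simp) _
  refine Infinite.of_injective (fun n : ℕ => word (List.replicate n false) x) fun m n hmn => ?_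
  rcases lt_trichotomy m n with hlt | rfl | hlt
  · obtain ⟨k, rfl⟩ := Nat.exists_eq_add_of_lt hlt
    exact (h m k hmn.symm).elim
  · rfl
  · obtain ⟨k, rfl⟩ := Nat.exists_eq_add_of_lt hlt
    exact (h n k hmn).elim

/-! #### Generic elements and thin sets -/

/-- The values at `x` of the words of length at most `D` are distinct and lie outside `C`. -/
def IsGeneric (D : ℕ) (C : Set M) (x : M) : Prop :=
  (∀ w : List Bool, w.length ≤ D → word w x ∉ C) ∧
    ∀ v w : List Bool, v.length ≤ D → w.length ≤ D → word v x = word w x → v = w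

/-- Pair two generic elements, the second also avoiding all short word values of the first, so that
their trees of values are disjoint. Acyclicity separates the root from its descendants. -/
theorem exists_isGeneric [Nonempty M] (D : ℕ) {C : Set M} (hC : C.Finite) :
    ∃ x, IsGeneric D C x := by
  induction D generalizing C with
  | zero =>
    have : Infinite M := infinite_of_nonempty
    obtain ⟨x, hx⟩ := hC.exists_notMem
    refine ⟨x, fun w hw => ?_, fun v w hv hw _ => ?_⟩
    · obtain rfl := List.length_eq_zero_iff.1 (Nat.le_zero.1 hw)
      exact hx
    · rw [List.length_eq_zero_iff.1 (Nat.le_zero.1 hw),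
        List.length_eq_zero_iff.1 (Nat.le_zero.1 hv)]
  | succ D ih =>
    -- Avoiding `step false '' C` keeps the root `pair x y` itself out of `C`.
    obtain ⟨x, hx, hx'⟩ := ih (hC.union (hC.image (step false)))
    have hfin : {y | ∃ w : List Bool, w.length ≤ D ∧ word w x = y}.Finite := by
      have := (List.finite_length_le Bool D).image fun w => word w x
      refine this.subset ?_
      rintro y ⟨w, hw, rfl⟩
      exact ⟨w, hw, rfl⟩
    obtain ⟨y, hy, hy'⟩ := ih (hC.union hfin)
    have key : ∀ v w : List Bool, v.length ≤ D → w.length ≤ D → word v x ≠ word w y :=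
      fun v w hv hw h => hy w hw (Or.inr ⟨v, hv, h⟩)
    refine ⟨pair x y, ?_, ?_⟩
    · rintro (_ | ⟨_ | _, w⟩) hw hmem
      · exact hx [] (by simp) (Or.inr ⟨_, hmem, by simp⟩)
      · exact hx w (by simpa using hw) (Or.inl (by simpa using hmem))
      · exact hy w (by simpa using hw) (Or.inl (by simpa using hmem))
    · rintro (_ | ⟨a, v⟩) (_ | ⟨b, w⟩) hv hw h
      · rfl
      · exact (word_ne (by simp) _ h.symm).elim
      · exact (word_ne (by simp) _ h).elim
      · have hv' : v.length ≤ D := by simpa using hv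
        have hw' : w.length ≤ D := by simpa using hw
        cases a <;> cases b <;> simp only [word_cons, step_false_pair, step_true_pair] at h
        · rw [hx' v w hv' hw' h]
        · exact (key v w hv' hw' h).elim
        · exact (key w v hw' hv' h.symm).elim
        · rw [hy' v w hv' hw' h]

/-- A set is thin if it contains no element that is generic with respect to suitable data. -/
def Thin (S : Set M) : Prop :=
  ∃ (D : ℕ) (C : Set M), C.Finite ∧ ∀ x ∈ S, ¬ IsGeneric D C x

theorem IsGeneric.mono {D D' : ℕ} {C C' : Set M} {x : M} (h : IsGeneric D' C' x) (hD : D ≤ D')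
    (hC : C ⊆ C') : IsGeneric D C x :=
  ⟨fun w hw hx => h.1 w (hw.trans hD) (hC hx),
    fun v w hv hw => h.2 v w (hv.trans hD) (hw.trans hD)⟩

theorem Thin.mono {S T : Set M} (hT : Thin T) (h : S ⊆ T) : Thin S := by
  obtain ⟨D, C, hC, hx⟩ := hT
  exact ⟨D, C, hC, fun x hxS => hx x (h hxS)⟩

theorem Thin.union {S T : Set M} (hS : Thin S) (hT : Thin T) : Thin (S ∪ T) := by
  obtain ⟨D, C, hC, hx⟩ := hS
  obtain ⟨D', C', hC', hx'⟩ := hT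
  refine ⟨max D D', C ∪ C', hC.union hC', ?_⟩
  rintro x (h | h) hg
  · exact hx x h (hg.mono (le_max_left _ _) Set.subset_union_left)
  · exact hx' x h (hg.mono (le_max_right _ _) Set.subset_union_right)

theorem thin_empty : Thin (∅ : Set M) := ⟨0, ∅, Set.finite_empty, fun _ h => h.elim⟩

theorem thin_singleton (a : M) : Thin ({a} : Set M) :=
  ⟨0, {a}, Set.finite_singleton a, fun _ hx h => h.1 [] le_rfl hx⟩

theorem thin_word_eq (w : List Bool) (c : M) : Thin {x | word w x = c} :=
  ⟨w.length, {c}, Set.finite_singleton c, fun _ hx h => h.1 w le_rfl hx⟩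

/-- Such a set can be infinite: `step false x = step true x` holds exactly at the elements `pair y
y`. This is why smallness means thin and not finite. -/
theorem thin_word_eq_word {v w : List Bool} (hvw : v ≠ w) : Thin {x : M | word v x = word w x} :=
  ⟨max v.length w.length, ∅, Set.finite_empty,
    fun _ hx h => hvw (h.2 v w (le_max_left _ _) (le_max_right _ _) hx)⟩

theorem thin_biUnion {ι : Type*} {I : Set ι} (hI : I.Finite) {S : ι → Set M}
    (h : ∀ i ∈ I, Thin (S i)) : Thin (⋃ i ∈ I, S i) := by
  induction I, hI using Set.Finite.induction_on with
  | empty => simpa using thin_empty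
  | insert _ _ ih =>
    rw [Set.biUnion_insert]
    exact (h _ (Set.mem_insert _ _)).union (ih fun i hi => h i (Set.mem_insert_of_mem _ hi))

/-- The thin sets thus form a proper ideal: finitely many of them never cover `M`. -/
theorem Thin.exists_notMem [Nonempty M] {S : Set M} (h : Thin S) : ∃ x, x ∉ S := by
  obtain ⟨D, C, hC, hx⟩ := h
  obtain ⟨x, hg⟩ := exists_isGeneric D hC
  exact ⟨x, fun hxS => hx x hxS hg⟩

/-! #### Regular functions and closed sets -/

/-- The functions whose value is a word applied to a coordinate of the argument, or a constant. -/
inductive IsAtom : ((α → M) → M) → Prop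
  | word (w : List Bool) (i : α) : IsAtom fun x => word w (x i)
  | const (c : M) : IsAtom fun _ => c

/-- The functions obtained from words applied to coordinates and constants by `pair`. -/
inductive IsRegular : ((α → M) → M) → Prop
  | atom {f : (α → M) → M} (hf : IsAtom f) : IsRegular f
  | pair {f g : (α → M) → M} (hf : IsRegular f) (hg : IsRegular g) :
      IsRegular fun x => pair (f x) (g x)

theorem IsAtom.step {f : (α → M) → M} (hf : IsAtom f) (b : Bool) :
    IsAtom fun x => step b (f x) := by
  cases hf with
  | word w i => simpa only [step_word] using IsAtom.word (w ++ [b]) i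
  | const c => exact .const _

theorem IsRegular.step {f : (α → M) → M} (hf : IsRegular f) (b : Bool) :
    IsRegular fun x => step b (f x) := by
  cases hf with
  | atom hf => exact .atom (hf.step b)
  | pair hf hg => cases b <;> simpa

theorem IsRegular.word_comp {f : (α → M) → M} (hf : IsRegular f) (w : List Bool) :
    IsRegular fun x => word w (f x) := by
  induction w generalizing f with
  | nil => exact hf
  | cons b w ih => exact ih (hf.step b)

theorem IsRegular.coord (i : α) : IsRegular fun x : α → M => x i := .atom (.word [] i)

theorem IsRegular.const (c : M) : IsRegular fun _ : α → M => c := .atom (.const c)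

theorem IsRegular.comp {f : (α → M) → M} (hf : IsRegular f) {φ : (β → M) → α → M}
    (hφ : ∀ i, IsRegular fun x => φ x i) : IsRegular fun x => f (φ x) := by
  induction hf with
  | atom hf =>
    cases hf with
    | word w i => exact (hφ i).word_comp w
    | const c => exact .const c
  | pair _ _ ihf ihg => exact .pair ihf ihg

/-- The sets defined by one equation between words applied to coordinates, or constants. -/
def IsEquation (E : Set (α → M)) : Prop :=
  ∃ f g : (α → M) → M, IsAtom f ∧ IsAtom g ∧ E = {x | f x = g x}

/-- The closed sets are the solution sets of finite systems of equations. -/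
def IsClosedSet (Z : Set (α → M)) : Prop :=
  ∃ 𝓔 : Set (Set (α → M)), 𝓔.Finite ∧ (∀ E ∈ 𝓔, IsEquation E) ∧ Z = ⋂₀ 𝓔

theorem IsEquation.isClosedSet {E : Set (α → M)} (h : IsEquation E) : IsClosedSet E :=
  ⟨{E}, Set.finite_singleton E, by simpa, by simp⟩

theorem isClosedSet_univ : IsClosedSet (Set.univ : Set (α → M)) :=
  ⟨∅, Set.finite_empty, by simp, by simp⟩

theorem isEquation_empty [Nonempty M] : IsEquation (∅ : Set (α → M)) := by
  obtain ⟨x⟩ := ‹Nonempty M›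
  refine ⟨_, _, .const x, .const (word [true] x), ?_⟩
  ext y
  simpa using! (word_ne (List.cons_ne_nil true []) x).symm

theorem IsClosedSet.inter {Y Z : Set (α → M)} (hY : IsClosedSet Y) (hZ : IsClosedSet Z) :
    IsClosedSet (Y ∩ Z) := by
  obtain ⟨𝓔, h1, h2, rfl⟩ := hY
  obtain ⟨𝓕, h3, h4, rfl⟩ := hZ
  refine ⟨𝓔 ∪ 𝓕, h1.union h3, ?_, (Set.sInter_union _ _).symm⟩
  rintro E (h | h)
  exacts [h2 E h, h4 E h]

theorem isClosedSet_biInter {ι : Type*} {I : Set ι} (hI : I.Finite) {Z : ι → Set (α → M)}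
    (h : ∀ i ∈ I, IsClosedSet (Z i)) : IsClosedSet (⋂ i ∈ I, Z i) := by
  induction I, hI using Set.Finite.induction_on with
  | empty => simpa using isClosedSet_univ
  | insert _ _ ih =>
    rw [Set.biInter_insert]
    exact (h _ (Set.mem_insert _ _)).inter (ih fun i hi => h i (Set.mem_insert_of_mem _ hi))

theorem isClosedSet_iInter {ι : Type*} [Finite ι] {Z : ι → Set (α → M)}
    (h : ∀ i, IsClosedSet (Z i)) : IsClosedSet (⋂ i, Z i) := by
  simpa using isClosedSet_biInter Set.finite_univ fun i _ => h i

/-- An equation with a `pair` on one side splits into two equations between components, and a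
component of an atom is an atom. -/
theorem IsAtom.isClosedSet_eq {f g : (α → M) → M} (hf : IsAtom f) (hg : IsRegular g) :
    IsClosedSet {x | f x = g x} := by
  induction hg generalizing f with
  | atom hg => exact IsEquation.isClosedSet ⟨f, _, hf, hg, rfl⟩
  | pair _ _ ihf ihg =>
    simp only [eq_pair_iff]
    exact (ihf (hf.step false)).inter (ihg (hf.step true))

theorem IsRegular.isClosedSet_eq {f g : (α → M) → M} (hf : IsRegular f) (hg : IsRegular g) :
    IsClosedSet {x | f x = g x} := by
  induction hf generalizing g with
  | atom hf => exact hf.isClosedSet_eq hg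
  | pair _ _ ihf ihg =>
    simp only [eq_comm (b := g _), eq_pair_iff]
    simp only [eq_comm (a := AcyclicPairing.step _ _)]
    exact (ihf (hg.step false)).inter (ihg (hg.step true))

theorem IsClosedSet.preimage {Z : Set (α → M)} (hZ : IsClosedSet Z) {φ : (β → M) → α → M}
    (hφ : ∀ i, IsRegular fun x => φ x i) : IsClosedSet (φ ⁻¹' Z) := by
  obtain ⟨𝓔, h1, h2, rfl⟩ := hZ
  rw [Set.preimage_sInter]
  refine isClosedSet_biInter h1 fun E hE => ?_
  obtain ⟨f, g, hf, hg, rfl⟩ := h2 E hE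
  exact ((IsRegular.atom hf).comp hφ).isClosedSet_eq ((IsRegular.atom hg).comp hφ)

/-! #### Closed sets and lines -/

section Lines

variable [DecidableEq α]

/-- Every line parallel to an axis is contained in `F` or meets it in a thin set. -/
def LineIrreducible (F : Set (α → M)) : Prop :=
  ∀ x i, (∀ t, Function.update x i t ∈ F) ∨ Thin {t | Function.update x i t ∈ F}

/-- As an equation in the `i`-th coordinate, `E` either imposes nothing or reads `word v t = word w
t` with `v ≠ w`, or `word w t = c`. Which case occurs does not depend on the other coordinates. -/
theorem IsEquation.update {E : Set (α → M)} (hE : IsEquation E) (i : α) :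
    (∀ x t, Function.update x i t ∈ E ↔ x ∈ E) ∨
      ∀ x, Thin {t | Function.update x i t ∈ E} := by
  have key : ∀ f : (α → M) → M, IsAtom f →
      (∀ x t, f (Function.update x i t) = f x) ∨ ∃ w, f = fun x => word w (x i) := by
    rintro f (⟨w, j⟩ | c)
    · by_cases h : j = i
      · subst h
        exact Or.inr ⟨w, rfl⟩
      · left
        intro x t
        simp [h]
    · exact Or.inl fun _ _ => rfl
  obtain ⟨f, g, hf, hg, rfl⟩ := hE
  rcases key f hf with hf | ⟨v, rfl⟩ <;> rcases key g hg with hg | ⟨w, rfl⟩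
  · left
    intro x t
    simp [hf, hg]
  · right
    intro x
    simpa [hf, eq_comm] using thin_word_eq w (f x)
  · right
    intro x
    simpa [hg] using thin_word_eq v (g x)
  · by_cases hvw : v = w
    · left
      intro x t
      simp [hvw]
    · right
      intro x
      simpa using thin_word_eq_word hvw

theorem IsClosedSet.lineIrreducible {Z : Set (α → M)} (hZ : IsClosedSet Z) :
    LineIrreducible Z := by
  obtain ⟨𝓔, h1, h2, rfl⟩ := hZ
  intro x i
  by_cases h : ∃ E ∈ 𝓔, Thin {t | Function.update x i t ∈ E}
  · obtain ⟨E, hE, hthin⟩ := h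
    exact Or.inr (hthin.mono fun t ht => ht E hE)
  · left
    intro t E hE
    rcases (h2 E hE).update i with h' | h'
    -- If `x` violates an invariant equation, the whole line misses `E`, and the empty set is thin.
    · by_contra hx
      refine h ⟨E, hE, thin_empty.mono fun s hs => hx ?_⟩
      rw [h']
      exact (h' x s).1 hs
    · exact (h ⟨E, hE, h' x⟩).elim

/-- A coordinate subspace is not covered by finitely many sets that do not contain it. -/
theorem exists_forall_notMem [Nonempty M] (K : Finset α) {𝓖 : Set (Set (α → M))}
    (hfin : 𝓖.Finite) (h𝓖 : ∀ G ∈ 𝓖, LineIrreducible G) (x : α → M)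
    (h : ∀ G ∈ 𝓖, ∃ y, (∀ i ∉ K, y i = x i) ∧ y ∉ G) :
    ∃ y, (∀ i ∉ K, y i = x i) ∧ ∀ G ∈ 𝓖, y ∉ G := by
  induction K using Finset.induction_on generalizing 𝓖 with
  | empty =>
    refine ⟨x, fun _ _ => rfl, fun G hG => ?_⟩
    obtain ⟨y, hy, hyG⟩ := h G hG
    rwa [funext fun i => hy i (Finset.notMem_empty i)] at hyG
  | insert j K hj ih =>
    -- First avoid the sets of points whose entire `j`-line lies in some `G`. On the `j`-line of the
    -- point found, each `G` is then thin, so one value of the coordinate avoids them all.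
    have := ih (𝓖 := (fun G => {y | ∀ t, Function.update y j t ∈ G}) '' 𝓖) (hfin.image _) ?_ ?_
    · obtain ⟨y, hy, hyG⟩ := this
      have hthin : Thin (⋃ G ∈ 𝓖, {t | Function.update y j t ∈ G}) :=
        thin_biUnion hfin fun G hG =>
          (h𝓖 G hG y j).resolve_left fun h' => hyG _ ⟨G, hG, rfl⟩ h'
      obtain ⟨t, ht⟩ := hthin.exists_notMem
      refine ⟨Function.update y j t, fun i hi => ?_, fun G hG hmem => ht ?_⟩
      · rw [Finset.mem_insert, not_or] at hi
        rw [Function.update_of_ne hi.1, hy i hi.2]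
      · simp only [Set.mem_iUnion]
        exact ⟨G, hG, hmem⟩
    · rintro _ ⟨G, hG, rfl⟩ y i
      by_cases hij : i = j
      · subst hij
        by_cases hy : ∀ t, Function.update y i t ∈ G
        · left
          intro s t
          simpa using hy t
        · right
          refine thin_empty.mono fun s hs => hy fun t => ?_
          simpa using hs t
      -- The new set is an intersection of slices of `G` over `t`: one thin slice makes it thin on
      -- the line, and otherwise every slice contains the line.
      · by_cases hy : ∃ t, Thin {s | Function.update (Function.update y j t) i s ∈ G}
        · obtain ⟨t, ht⟩ := hy
          right
          refine ht.mono fun s hs => ?_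
          rw [Set.mem_ofPred_eq, Function.update_comm (Ne.symm hij)]
          exact hs t
        · push Not at hy
          left
          intro s t
          rw [Function.update_comm hij]
          exact (h𝓖 G hG _ i).resolve_right (hy t) s
    · rintro _ ⟨G, hG, rfl⟩
      obtain ⟨y, hy, hyG⟩ := h G hG
      refine ⟨Function.update y j (x j), fun i hi => ?_, fun hmem => hyG ?_⟩
      · by_cases hij : i = j
        · subst hij; simp
        · rw [Function.update_of_ne hij]
          exact hy i (by simp [hij, hi])
      · simpa using hmem (y j)

/-- The points all of whose translates in the directions of `K` lie in a given closed set. -/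
theorem IsClosedSet.isClosedSet_forall [Nonempty M] {Z : Set (α → M)} (hZ : IsClosedSet Z)
    (K : Finset α) : IsClosedSet {x | ∀ y, (∀ i ∉ K, y i = x i) → y ∈ Z} := by
  obtain ⟨𝓔, h1, h2, rfl⟩ := hZ
  have : {x : α → M | ∀ y, (∀ i ∉ K, y i = x i) → y ∈ ⋂₀ 𝓔} =
      ⋂ E ∈ 𝓔, {x | ∀ y, (∀ i ∉ K, y i = x i) → y ∈ E} := by
    ext x
    simp only [Set.mem_ofPred_eq, Set.mem_sInter, Set.mem_iInter]
    exact ⟨fun h E hE y hy => h y hy E hE, fun h y hy E hE => h E hE y hy⟩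
  rw [this]
  refine isClosedSet_biInter h1 fun E hE => ?_
  -- If `E` is thin in some direction of `K`, it contains no full translate and the condition
  -- defines the empty set. Otherwise `E` is invariant in all directions of `K` and the condition is
  -- membership in `E`.
  by_cases h : ∃ i ∈ K, ∀ x, Thin {t | Function.update x i t ∈ E}
  · obtain ⟨i, hi, hthin⟩ := h
    convert! (isEquation_empty (M := M) (α := α)).isClosedSet
    rw [Set.eq_empty_iff_forall_notMem]
    intro x hx
    obtain ⟨t, ht⟩ := (hthin x).exists_notMem
    refine ht (hx _ fun j hj => Function.update_of_ne ?_ _ _)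
    rintro rfl
    exact hj hi
  · have hinv : ∀ i ∈ K, ∀ x t, Function.update x i t ∈ E ↔ x ∈ E := fun i hi =>
      ((h2 E hE).update i).resolve_right fun h' => h ⟨i, hi, h'⟩
    have hmem : ∀ x y, (∀ i ∉ K, y i = x i) → (y ∈ E ↔ x ∈ E) := by
      clear h this
      induction K using Finset.induction_on with
      | empty =>
        intro x y hy
        rw [funext fun i => hy i (Finset.notMem_empty i)]
      | insert j K hj ih =>
        intro x y hy
        rw [← hinv j (Finset.mem_insert_self j K) y (x j)]
        refine ih
          (fun i hi => hinv i (Finset.mem_insert_of_mem hi)) x _ fun i hi => ?_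
        by_cases hij : i = j
        · subst hij; simp
        · rw [Function.update_of_ne hij]
          exact hy i (by simp [hij, hi])
    convert! (h2 E hE).isClosedSet
    ext x
    exact ⟨fun hx => hx x fun _ _ => rfl, fun hx y hy => (hmem x y hy).2 hx⟩

end Lines

end AcyclicPairing

namespace AcyclicPairing

/-! #### Terms and unification -/

/-- Terms built from `k` variables and constants by the pairing operation. -/
inductive PairTerm (M : Type*) (k : ℕ)
  | var (j : Fin k) : PairTerm M k
  | const (c : M) : PairTerm M k
  | pair (s t : PairTerm M k) : PairTerm M k

variable {M : Type*} [AcyclicPairing M] {α β : Type*} {k m n : ℕ}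

namespace PairTerm

/-- The value of a term. -/
def eval (u : Fin k → M) : PairTerm M k → M
  | var j => u j
  | const c => c
  | pair s t => AcyclicPairing.pair (s.eval u) (t.eval u)

/-- Simultaneous substitution of terms for the variables. -/
def subst (σ : Fin k → PairTerm M m) : PairTerm M k → PairTerm M m
  | var j => σ j
  | const c => const c
  | pair s t => pair (s.subst σ) (t.subst σ)

/-- The variable `j` occurs in a term. -/
def Occurs (j : Fin k) : PairTerm M k → Prop
  | var i => i = j
  | const _ => False
  | pair s t => s.Occurs j ∨ t.Occurs j

theorem eval_subst (σ : Fin k → PairTerm M m) (u : Fin m → M) (t : PairTerm M k) :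
    (t.subst σ).eval u = t.eval fun j => (σ j).eval u := by
  induction t with
  | var j => rfl
  | const c => rfl
  | pair s t hs ht => simp [PairTerm.subst, eval, hs, ht]

theorem eval_congr {u v : Fin k → M} (t : PairTerm M k) (h : ∀ j, t.Occurs j → u j = v j) :
    t.eval u = t.eval v := by
  induction t with
  | var j => exact h j rfl
  | const c => rfl
  | pair s t hs ht =>
    simp only [eval]
    rw [hs fun j hj => h j (Or.inl hj), ht fun j hj => h j (Or.inr hj)]

theorem isRegular_eval (t : PairTerm M k) : IsRegular fun u => t.eval u := by
  induction t with
  | var j => exact .coord j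
  | const c => exact .const c
  | pair s t hs ht => exact .pair hs ht

/-- The word is the path from the root of the term to the occurrence. It serves both the occurs
check and the recovery of parameters from values. -/
theorem Occurs.exists_word {j : Fin k} {t : PairTerm M k} (h : t.Occurs j) :
    ∃ w, (∀ u : Fin k → M, word w (t.eval u) = u j) ∧ (w = [] → t = var j) := by
  induction t with
  | var i =>
    obtain rfl : i = j := h
    exact ⟨[], fun _ => rfl, fun _ => rfl⟩
  | const c => exact h.elim
  | pair s t hs ht =>
    rcases h with h | h
    · obtain ⟨w, hw, -⟩ := hs h
      exact ⟨false :: w, by simpa [eval] using hw, by simp⟩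
    · obtain ⟨w, hw, -⟩ := ht h
      exact ⟨true :: w, by simpa [eval] using hw, by simp⟩

/-- The map between Cartesian powers of `M` whose coordinates are given by terms. -/
def evalMap (φ : α → PairTerm M k) (u : Fin k → M) : α → M := fun i => (φ i).eval u

theorem evalMap_subst (φ : α → PairTerm M k) (σ : Fin k → PairTerm M m) (u : Fin m → M) :
    evalMap (fun i => (φ i).subst σ) u = evalMap φ (evalMap σ u) :=
  funext fun i => eval_subst σ u (φ i)

theorem isRegular_evalMap (φ : α → PairTerm M k) (i : α) : IsRegular fun u => evalMap φ u i :=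
  isRegular_eval (φ i)

end PairTerm

open PairTerm

/-- The possible outcomes of unification: all points are solutions, or none is, or the solutions
are parametrized by fewer variables. -/
def IsSolved (S : Set (Fin k → M)) : Prop :=
  S = Set.univ ∨ S = ∅ ∨
    ∃ m < k, ∃ φ : Fin k → PairTerm M m,
      Function.Injective (evalMap φ) ∧ Set.range (evalMap φ) = S

/-- A parametrization of `S` is substituted into the second equation. It uses fewer variables, so
the hypothesis on smaller `m` applies. -/
theorem isSolved_inter (ih : ∀ m < k, ∀ s t : PairTerm M m, IsSolved {u | s.eval u = t.eval u})
    {S : Set (Fin k → M)} {s t : PairTerm M k} (h : IsSolved S)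
    (h' : IsSolved {u | s.eval u = t.eval u}) : IsSolved (S ∩ {u | s.eval u = t.eval u}) := by
  rcases h with rfl | rfl | ⟨m, hm, φ, hφ, rfl⟩
  · rwa [Set.univ_inter]
  · exact Or.inr (Or.inl (Set.empty_inter _))
  · rw [← Set.image_preimage_eq_range_inter]
    have hpre : evalMap φ ⁻¹' {u | s.eval u = t.eval u} =
        {u | (s.subst φ).eval u = (t.subst φ).eval u} := by
      ext u
      simp only [Set.mem_preimage, Set.mem_ofPred_eq, eval_subst]
      rfl
    rw [hpre]
    rcases ih m hm (s.subst φ) (t.subst φ) with h | h | ⟨l, hl, σ, hσ, h⟩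
    · exact Or.inr (Or.inr ⟨m, hm, φ, hφ, by rw [h, Set.image_univ]⟩)
    · exact Or.inr (Or.inl (by rw [h, Set.image_empty]))
    · refine Or.inr (Or.inr ⟨l, hl.trans hm, fun i => (φ i).subst σ, ?_, ?_⟩)
      · intro u v huv
        simp only [evalMap_subst] at huv
        exact hσ (hφ huv)
      · rw [← h, ← Set.range_comp]
        congr 1
        exact funext fun u => evalMap_subst φ σ u

/-- If `j` occurs in `t` and `t` is not `var j`, a nonempty word would fix `u j`, contrary to
acyclicity. If `j` does not occur, the variable is eliminated by substituting `t`. -/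
theorem isSolved_var_eq [Nonempty M] (j : Fin k) (t : PairTerm M k) :
    IsSolved {u : Fin k → M | u j = t.eval u} := by
  by_cases ht : t = var j
  · subst ht
    exact Or.inl (by ext; simp [eval])
  by_cases hj : t.Occurs j
  · right; left
    rw [Set.eq_empty_iff_forall_notMem]
    intro u hu
    obtain ⟨w, hw, hw'⟩ := hj.exists_word
    have hne : w ≠ [] := fun h => ht (hw' h)
    refine word_ne hne (u j) ?_
    conv_lhs => rw [show u j = t.eval u from hu]
    exact hw u
  · obtain _ | k := k
    · exact j.elim0
    obtain ⟨c⟩ := ‹Nonempty M›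
    right; right
    -- Only a renaming of the other variables: the value `c` at `j` is never seen because `j` does
    -- not occur in `t`.
    let σ : Fin (k + 1) → PairTerm M k := j.insertNth (.const c) .var
    let φ : Fin (k + 1) → PairTerm M k := j.insertNth (t.subst σ) .var
    have h1 : ∀ u i, evalMap φ u (j.succAbove i) = u i := fun u i => by simp [φ, evalMap, eval]
    have h2 : ∀ (u : Fin k → M) (v : Fin (k + 1) → M), (∀ i, v (j.succAbove i) = u i) →
        (t.subst σ).eval u = t.eval v := by
      intro u v huv
      rw [eval_subst]
      refine eval_congr t fun i hi => ?_
      obtain ⟨i, rfl⟩ := Fin.exists_succAbove_eq (show i ≠ j by rintro rfl; exact hj hi)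
      simp [σ, eval, huv]
    have h3 : ∀ u, evalMap φ u j = (t.subst σ).eval u := fun u => by simp [φ, evalMap]
    refine ⟨k, k.lt_succ_self, φ, fun u v huv => ?_, Set.Subset.antisymm ?_ fun v hv => ?_⟩
    · funext i
      rw [← h1 u, ← h1 v, huv]
    · rintro _ ⟨u, rfl⟩
      exact (h3 u).trans (h2 u _ (h1 u))
    · refine ⟨fun i => v (j.succAbove i), ?_⟩
      funext i
      obtain rfl | ⟨i, rfl⟩ := Fin.eq_self_or_eq_succAbove j i
      · rw [h3, h2 _ v fun _ => rfl]
        exact hv.symm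
      · rw [h1]

theorem isSolved_eq_symm {s t : PairTerm M k} (h : IsSolved {u : Fin k → M | s.eval u = t.eval u}) :
    IsSolved {u : Fin k → M | t.eval u = s.eval u} := by
  simpa only [eq_comm] using h

/-- Unification, by strong induction on the number of variables and, inside it, by structural
induction on terms. -/
theorem isSolved_eq [Nonempty M] (s t : PairTerm M k) :
    IsSolved {u : Fin k → M | s.eval u = t.eval u} := by
  induction k using Nat.strong_induction_on with
  | _ k ih =>
    -- Constants are not atomic: `c` equals `pair (step false c) (step true c)`. The recursion
    -- therefore runs on `s` with `c` varying.
    have hconst : ∀ (s : PairTerm M k) (c : M),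
        IsSolved {u : Fin k → M | s.eval u = (const c).eval u} := by
      intro s
      induction s with
      | var j => exact fun c => isSolved_var_eq j _
      | const d =>
        intro c
        by_cases h : d = c
        · exact Or.inl (by ext; simp [eval, h])
        · exact Or.inr (Or.inl (by ext; simp [eval, h]))
      | pair s₁ s₂ h₁ h₂ =>
        intro c
        convert! isSolved_inter ih (h₁ (step false c)) (h₂ (step true c)) using 1
        ext u
        simp only [eval, Set.mem_ofPred_eq, Set.mem_inter_iff]
        rw [eq_comm, eq_pair_iff]
        tauto
    induction s generalizing t with
    | var j => exact isSolved_var_eq j t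
    | const c => exact isSolved_eq_symm (hconst t c)
    | pair s₁ s₂ h₁ h₂ =>
      cases t with
      | var j => exact isSolved_eq_symm (isSolved_var_eq j _)
      | const c => exact hconst _ c
      | pair t₁ t₂ =>
        convert! isSolved_inter ih (h₁ t₁) (h₂ t₂) using 1
        ext u
        simp [eval, eq_pair_iff]

/-- A substitution that makes all words of length at most `D` in the variables equal to terms. -/
theorem exists_bijective_split (k D : ℕ) :
    ∃ (m : ℕ) (θ : Fin k → PairTerm M m), Function.Bijective (evalMap θ) ∧
      ∀ w : List Bool, w.length ≤ D → ∀ i,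
        ∃ s : PairTerm M m, ∀ u, word w ((θ i).eval u) = s.eval u := by
  induction D with
  | zero =>
    refine ⟨k, .var, Function.bijective_id, fun w hw i => ⟨.var i, fun u => ?_⟩⟩
    rw [List.length_eq_zero_iff.1 (Nat.le_zero.1 hw)]
    rfl
  | succ D ih =>
    obtain ⟨m, θ, hθ, hw⟩ := ih
    -- Each variable becomes a pair of fresh variables, which is a bijective change of parameters
    -- since `pair` is a bijection.
    let σ : Fin m → PairTerm M (m + m) := fun j =>
      .pair (.var (Fin.castAdd m j)) (.var (Fin.natAdd m j))
    have hσ : Function.Bijective (evalMap σ) := by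
      constructor
      · intro u v huv
        have h : ∀ j, u (Fin.castAdd m j) = v (Fin.castAdd m j) ∧
            u (Fin.natAdd m j) = v (Fin.natAdd m j) := by
          intro j
          have := congrFun huv j
          simpa [evalMap, σ, eval, eq_pair_iff] using this
        funext j
        exact Fin.addCases (fun j => (h j).1) (fun j => (h j).2) j
      · intro v
        refine ⟨Fin.append (fun j => step false (v j)) fun j => step true (v j), ?_⟩
        funext j
        simp [evalMap, σ, eval, -Fin.natAdd_eq_addNat]
    have hstep : ∀ (b : Bool) (s : PairTerm M m),
        ∃ t : PairTerm M (m + m), ∀ u, step b ((s.subst σ).eval u) = t.eval u := by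
      rintro b (j | c | ⟨s, t⟩)
      · cases b
        · exact ⟨.var (Fin.castAdd m j), fun u => by
            simp [PairTerm.subst, σ, eval, -Fin.natAdd_eq_addNat]⟩
        · exact ⟨.var (Fin.natAdd m j), fun u => by
            simp [PairTerm.subst, σ, eval, -Fin.natAdd_eq_addNat]⟩
      · exact ⟨.const (step b c), fun u => rfl⟩
      · cases b
        · exact ⟨s.subst σ, fun u => by simp [PairTerm.subst, eval]⟩
        · exact ⟨t.subst σ, fun u => by simp [PairTerm.subst, eval]⟩
    refine ⟨m + m, fun i => (θ i).subst σ, ?_, fun w hlen i => ?_⟩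
    · rw [show evalMap (fun i => (θ i).subst σ) = evalMap θ ∘ evalMap σ from
        funext fun u => evalMap_subst θ σ u]
      exact hθ.comp hσ
    -- The last letter is split off because it is applied last: the earlier letters already give a
    -- term, and `σ` makes one further step a term.
    · obtain rfl | ⟨w, b, rfl⟩ := List.eq_nil_or_concat w
      · exact ⟨(θ i).subst σ, fun u => rfl⟩
      · obtain ⟨s, hs⟩ := hw w (by simpa using hlen) i
        obtain ⟨t, ht⟩ := hstep b s
        refine ⟨t, fun u => ?_⟩
        rw [List.concat_eq_append, ← step_word, ← ht, eval_subst, eval_subst, hs]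

/-- `D` bounds the lengths of the words occurring in `f`, so splitting to depth `D` turns `f` into a
term. -/
theorem IsRegular.exists_eval_eq {f : (Fin k → M) → M} (hf : IsRegular f) :
    ∃ D : ℕ, ∀ (m : ℕ) (θ : Fin k → PairTerm M m),
      (∀ w : List Bool, w.length ≤ D → ∀ i,
        ∃ s : PairTerm M m, ∀ u, word w ((θ i).eval u) = s.eval u) →
      ∃ s : PairTerm M m, ∀ u, f (evalMap θ u) = s.eval u := by
  induction hf with
  | atom hf =>
    cases hf with
    | word w i => exact ⟨w.length, fun m θ hθ => hθ w le_rfl i⟩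
    | const c => exact ⟨0, fun m θ hθ => ⟨.const c, fun u => rfl⟩⟩
  | pair _ _ ihf ihg =>
    obtain ⟨D, hD⟩ := ihf
    obtain ⟨D', hD'⟩ := ihg
    refine ⟨max D D', fun m θ hθ => ?_⟩
    obtain ⟨s, hs⟩ := hD m θ fun w hw => hθ w (hw.trans (le_max_left _ _))
    obtain ⟨t, ht⟩ := hD' m θ fun w hw => hθ w (hw.trans (le_max_right _ _))
    exact ⟨.pair s t, fun u => by simp only [eval, hs, ht]⟩

theorem IsRegular.eq_empty_or_exists_param [Nonempty M] {f g : (Fin k → M) → M}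
    (hf : IsRegular f) (hg : IsRegular g) :
    {u | f u = g u} = ∅ ∨ ∃ (m : ℕ) (φ : Fin k → PairTerm M m),
      Function.Injective (evalMap φ) ∧ Set.range (evalMap φ) = {u | f u = g u} := by
  obtain ⟨D, hD⟩ := hf.exists_eval_eq
  obtain ⟨D', hD'⟩ := hg.exists_eval_eq
  obtain ⟨m, θ, hθ, hw⟩ := exists_bijective_split (M := M) k (max D D')
  obtain ⟨s, hs⟩ := hD m θ fun w h => hw w (h.trans (le_max_left _ _))
  obtain ⟨t, ht⟩ := hD' m θ fun w h => hw w (h.trans (le_max_right _ _))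
  have himg : {u | f u = g u} = evalMap θ '' {u | s.eval u = t.eval u} := by
    rw [← Set.image_preimage_eq {u | f u = g u} hθ.2]
    congr 1
    ext u
    simp [hs, ht]
  rw [himg]
  rcases isSolved_eq s t with h | h | ⟨l, -, σ, hσ, h⟩
  · exact Or.inr ⟨m, θ, hθ.1, by rw [h, Set.image_univ]⟩
  · exact Or.inl (by rw [h, Set.image_empty])
  · refine Or.inr ⟨l, fun i => (θ i).subst σ, ?_, ?_⟩
    · intro u v huv
      simp only [evalMap_subst] at huv
      exact hσ (hθ.1 huv)
    · rw [← h, ← Set.range_comp]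
      congr 1
      exact funext fun u => evalMap_subst θ σ u

/-- A nonempty closed set has an injective parametrization by terms. -/
theorem IsClosedSet.exists_param [Nonempty M] [Finite α] {Z : Set (α → M)} (hZ : IsClosedSet Z)
    (hne : Z.Nonempty) : ∃ (m : ℕ) (φ : α → PairTerm M m),
      Function.Injective (evalMap φ) ∧ Set.range (evalMap φ) = Z := by
  obtain ⟨𝓔, h1, h2, rfl⟩ := hZ
  induction 𝓔, h1 using Set.Finite.induction_on with
  | empty =>
    obtain ⟨n, ⟨e⟩⟩ := Finite.exists_equiv_fin α
    refine ⟨n, fun i => .var (e i), fun u v huv => funext fun j => ?_, ?_⟩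
    · simpa [evalMap, eval] using congrFun huv (e.symm j)
    · rw [Set.sInter_empty, Set.eq_univ_iff_forall]
      exact fun v => ⟨fun j => v (e.symm j), by funext i; simp [evalMap, eval]⟩
  | @insert E 𝓔 _ _ ih =>
    rw [Set.sInter_insert] at hne ⊢
    obtain ⟨m, φ, hφ, hr⟩ := ih (fun F hF => h2 F (Set.mem_insert_of_mem _ hF))
      (hne.mono Set.inter_subset_right)
    obtain ⟨f, g, hf, hg, rfl⟩ := h2 E (Set.mem_insert _ _)
    -- The new equation is pulled back to the parameter space of the previous ones and solved there.
    rw [Set.inter_comm, ← hr, ← Set.image_preimage_eq_range_inter] at hne ⊢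
    rcases ((IsRegular.atom hf).comp (isRegular_evalMap φ)).eq_empty_or_exists_param
      ((IsRegular.atom hg).comp (isRegular_evalMap φ)) with h | ⟨l, σ, hσ, h⟩
    · exact (hne.ne_empty (by rw [Set.preimage_ofPred_eq, h, Set.image_empty])).elim
    · refine ⟨l, fun i => (φ i).subst σ, ?_, ?_⟩
      · intro u v huv
        simp only [evalMap_subst] at huv
        exact hσ (hφ huv)
      · rw [Set.preimage_ofPred_eq, ← h, ← Set.range_comp]
        congr 1
        exact funext fun u => evalMap_subst φ σ u

/-! #### Images of term maps -/

/-- The variables that occur in a family of terms can be recovered from the values of the terms. -/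
theorem exists_recover [Nonempty M] (φ : α → PairTerm M k) :
    ∃ ψ : (α → M) → Fin k → M, (∀ j, IsRegular fun x => ψ x j) ∧
      ∀ u j, (∃ i, (φ i).Occurs j) → ψ (evalMap φ u) j = u j := by
  obtain ⟨c⟩ := ‹Nonempty M›
  have : ∀ j : Fin k, ∃ f : (α → M) → M, IsRegular f ∧
      ∀ u, (∃ i, (φ i).Occurs j) → f (evalMap φ u) = u j := by
    intro j
    by_cases h : ∃ i, (φ i).Occurs j
    · obtain ⟨i, hi⟩ := h
      obtain ⟨w, hw, -⟩ := hi.exists_word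
      exact ⟨_, .atom (.word w i), fun u _ => hw u⟩
    -- Variables that do not occur cannot be recovered; they receive an arbitrary constant.
    · exact ⟨_, .const c, fun u h' => (h h').elim⟩
  choose f hf hf' using this
  exact ⟨fun x j => f j x, hf, fun u j => hf' j u⟩

theorem evalMap_congr {φ : α → PairTerm M k} {u v : Fin k → M}
    (h : ∀ j, (∃ i, (φ i).Occurs j) → u j = v j) : evalMap φ u = evalMap φ v :=
  funext fun i => eval_congr _ fun j hj => h j ⟨i, hj⟩

/-- With `ψ` recovering the occurring variables, `x` lies in the range exactly when `evalMap φ (ψ x)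
= x`, a finite system of regular equations. Injectivity of `evalMap φ` is not needed. -/
theorem isClosedSet_range_evalMap [Nonempty M] [Finite α] (φ : α → PairTerm M k) :
    IsClosedSet (Set.range (evalMap φ)) := by
  obtain ⟨ψ, hψ, hψ'⟩ := exists_recover φ
  have : Set.range (evalMap φ) = ⋂ i, {x | evalMap φ (ψ x) i = x i} := by
    ext x
    simp only [Set.mem_iInter, Set.mem_ofPred_eq, ← funext_iff]
    constructor
    · rintro ⟨u, rfl⟩
      exact evalMap_congr (hψ' u)
    · exact fun h => ⟨_, h⟩
  rw [this]
  exact isClosedSet_iInter fun i =>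
    ((isRegular_evalMap φ i).comp hψ).isClosedSet_eq (.coord i)

/-- A nonempty closed set is irreducible. -/
theorem IsClosedSet.exists_mem_forall_notMem [Nonempty M] [Finite α] {Z : Set (α → M)}
    (hZ : IsClosedSet Z) (hne : Z.Nonempty) {𝓖 : Set (Set (α → M))} (hfin : 𝓖.Finite)
    (h𝓖 : ∀ G ∈ 𝓖, IsClosedSet G ∧ ¬ Z ⊆ G) : ∃ x ∈ Z, ∀ G ∈ 𝓖, x ∉ G := by
  obtain ⟨m, φ, -, rfl⟩ := hZ.exists_param hne
  obtain ⟨c⟩ := ‹Nonempty M›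
  -- In the parameter space all coordinates are free to move, so the base point is irrelevant.
  obtain ⟨u, -, hu⟩ := exists_forall_notMem Finset.univ (𝓖 := (evalMap φ ⁻¹' ·) '' 𝓖)
    (hfin.image _) (by
      rintro _ ⟨G, hG, rfl⟩
      exact ((h𝓖 G hG).1.preimage (isRegular_evalMap φ)).lineIrreducible) (fun _ => c) (by
      rintro _ ⟨G, hG, rfl⟩
      obtain ⟨_, ⟨u, rfl⟩, hu⟩ := Set.not_subset.1 (h𝓖 G hG).2
      exact ⟨u, by simp, hu⟩)
  exact ⟨_, ⟨u, rfl⟩, fun G hG hmem => hu _ ⟨G, hG, rfl⟩ hmem⟩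

/-- A coordinate projection that is injective on a nonempty difference of a closed set and a
finite union of closed sets is injective on the closed set. -/
theorem IsClosedSet.injOn_of_injOn_diff [Nonempty M] [Finite β] {Z : Set (β → M)}
    (hZ : IsClosedSet Z) {𝓖 : Set (Set (β → M))} (hfin : 𝓖.Finite)
    (h𝓖 : ∀ G ∈ 𝓖, IsClosedSet G) (hne : (Z \ ⋃₀ 𝓖).Nonempty) {ρ : α → β}
    (hinj : Set.InjOn (fun x i => x (ρ i)) (Z \ ⋃₀ 𝓖)) :
    Set.InjOn (fun x i => x (ρ i)) Z := by
  obtain ⟨m, φ, hφ, rfl⟩ := hZ.exists_param (hne.mono Set.sdiff_subset)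
  obtain ⟨ψ, -, hψ⟩ := exists_recover fun i => φ (ρ i)
  -- If every parameter occurs among the projected coordinates, the projection determines all
  -- parameters.
  suffices h : ∀ j, ∃ i, (φ (ρ i)).Occurs j by
    rintro _ ⟨u, rfl⟩ _ ⟨v, rfl⟩ huv
    have : u = v := funext fun j => by
      rw [← hψ u j (h j), ← hψ v j (h j)]
      exact congrArg (fun x => ψ x j) huv
    rw [this]
  intro j
  by_contra hj
  obtain ⟨_, ⟨u, rfl⟩, hu⟩ := hne
  -- A parameter `j` that the projection does not see can be moved without changing the projected
  -- point. A value other than `u j` that stays outside `⋃₀ 𝓖` contradicts injectivity there.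
  have hthin : Thin ({u j} ∪ ⋃ G ∈ 𝓖, {t | Function.update u j t ∈ evalMap φ ⁻¹' G}) := by
    refine (thin_singleton _).union (thin_biUnion hfin fun G hG => ?_)
    refine (((h𝓖 G hG).preimage (isRegular_evalMap φ)).lineIrreducible u j).resolve_left
      fun h => hu ⟨G, hG, ?_⟩
    simpa using h (u j)
  obtain ⟨t, ht⟩ := hthin.exists_notMem
  simp only [Set.mem_union, Set.mem_singleton_iff, Set.mem_iUnion, not_or, not_exists] at ht
  have := hinj ⟨⟨_, rfl⟩, ?_⟩ ⟨⟨u, rfl⟩, hu⟩ (x₁ := evalMap φ (Function.update u j t)) ?_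
  · have := congrFun (hφ this) j
    exact ht.1 (by simpa using this)
  · rintro ⟨G, hG, hmem⟩
    exact ht.2 G hG hmem
  · refine evalMap_congr (φ := fun i => φ (ρ i)) fun i hi => Function.update_of_ne ?_ _ _
    rintro rfl
    exact hj hi

end AcyclicPairing

/-! ### Sets decided by a finite family -/

section Decided

variable {X : Type*}

/-- Membership in `A` depends only on membership in the sets of the family `𝓔`. -/
def IsDecided (𝓔 : Set (Set X)) (A : Set X) : Prop :=
  ∀ x y, (∀ E ∈ 𝓔, x ∈ E ↔ y ∈ E) → x ∈ A → y ∈ A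

theorem IsDecided.mono {𝓔 𝓕 : Set (Set X)} {A : Set X} (h : IsDecided 𝓔 A) (h𝓕 : 𝓔 ⊆ 𝓕) :
    IsDecided 𝓕 A :=
  fun x y hxy => h x y fun E hE => hxy E (h𝓕 hE)

/-- A property of sets holds for all sets decided by a finite family `𝓔` if it is compatible with
disjoint unions and holds for the differences of a basic set and a union of members of `𝓔`. -/
theorem IsDecided.induction {𝒵 𝓔 : Set (Set X)} (hfin : 𝓔.Finite)
    (h𝒵 : ∀ Z ∈ 𝒵, ∀ E ∈ 𝓔, Z ∩ E ∈ 𝒵) {Q : Set X → Prop} (hempty : Q ∅)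
    (hunion : ∀ A B, Disjoint A B → Q A → Q B → Q (A ∪ B))
    (hdiff : ∀ Z ∈ 𝒵, ∀ 𝓝 ⊆ 𝓔, Q (Z \ ⋃₀ 𝓝)) {A Z : Set X} (hA : IsDecided 𝓔 A) (hZ : Z ∈ 𝒵) :
    Q (Z ∩ A) := by
  suffices h : ∀ 𝓕 : Set (Set X), 𝓕.Finite → 𝓕 ⊆ 𝓔 → ∀ A, IsDecided 𝓕 A → ∀ Z ∈ 𝒵, ∀ 𝓝 ⊆ 𝓔,
      Q ((Z ∩ A) \ ⋃₀ 𝓝) by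
    simpa using h 𝓔 hfin subset_rfl A hA Z hZ ∅ (Set.empty_subset _)
  intro 𝓕 h𝓕
  induction 𝓕, h𝓕 using Set.Finite.induction_on with
  | empty =>
    intro _ A hA Z hZ 𝓝 h𝓝
    obtain rfl | ⟨a, ha⟩ := A.eq_empty_or_nonempty
    · simpa using hempty
    · rw [Set.eq_univ_of_forall fun y => hA a y (by simp) ha, Set.inter_univ]
      exact hdiff Z hZ 𝓝 h𝓝
  | @insert E 𝓕 _ _ ih =>
    intro h𝓕 A hA Z hZ 𝓝 h𝓝
    have hE : E ∈ 𝓔 := h𝓕 (Set.mem_insert _ _)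
    have h𝓕' : 𝓕 ⊆ 𝓔 := (Set.subset_insert _ _).trans h𝓕
    -- The saturation of `A ∩ E` under agreement on `𝓕` no longer depends on `E`, and it coincides
    -- with `A` inside `E`. The same holds for `A \ E` outside `E`.
    have hdec : ∀ B : Set X, IsDecided 𝓕 {x | ∃ y ∈ B, ∀ F ∈ 𝓕, y ∈ F ↔ x ∈ F} := by
      rintro B x x' hx ⟨y, hy, hxy⟩
      exact ⟨y, hy, fun F hF => (hxy F hF).trans (hx F hF)⟩
    have h1 := ih h𝓕' _ (hdec (A ∩ E)) _ (h𝒵 Z hZ E hE) 𝓝 h𝓝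
    have h2 := ih h𝓕' _ (hdec (A \ E)) Z hZ (insert E 𝓝) (Set.insert_subset hE h𝓝)
    convert! hunion _ _ ?_ h1 h2 using 1
    · ext x
      simp only [Set.mem_sdiff, Set.mem_inter_iff, Set.mem_union, Set.mem_ofPred_eq,
        Set.sUnion_insert, not_or]
      constructor
      · rintro ⟨⟨hxZ, hxA⟩, hxN⟩
        by_cases hxE : x ∈ E
        · exact Or.inl ⟨⟨⟨hxZ, hxE⟩, x, ⟨hxA, hxE⟩, fun _ _ => Iff.rfl⟩, hxN⟩
        · exact Or.inr ⟨⟨hxZ, x, ⟨hxA, hxE⟩, fun _ _ => Iff.rfl⟩, hxE, hxN⟩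
      · rintro (⟨⟨⟨hxZ, hxE⟩, y, ⟨hyA, hyE⟩, hxy⟩, hxN⟩ | ⟨⟨hxZ, y, ⟨hyA, hyE⟩, hxy⟩, hxE, hxN⟩)
        · refine ⟨⟨hxZ, hA y x ?_ hyA⟩, hxN⟩
          rintro F (rfl | hF)
          exacts [iff_of_true hyE hxE, hxy F hF]
        · refine ⟨⟨hxZ, hA y x ?_ hyA⟩, hxN⟩
          rintro F (rfl | hF)
          exacts [iff_of_false hyE hxE, hxy F hF]
    · rw [Set.disjoint_left]
      rintro x ⟨⟨⟨-, hxE⟩, -⟩, -⟩ ⟨-, hxE'⟩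
      exact hxE' ⟨E, Set.mem_insert _ _, hxE⟩

/-- With `U = ⋃₀ 𝓝`, one has `Z \ (N ∪ U) = (Z \ U) \ ((Z ∩ N) \ U)`, a difference of nested sets
with fewer sets removed. -/
theorem sdiff_sUnion_induction {𝒵 𝓝 : Set (Set X)} (hfin : 𝓝.Finite)
    (h𝒵 : ∀ Z ∈ 𝒵, ∀ N ∈ 𝓝, Z ∩ N ∈ 𝒵) {Q : Set X → Prop} (hbasic : ∀ Z ∈ 𝒵, Q Z)
    (hdiff : ∀ A B, A ⊆ B → Q A → Q B → Q (B \ A)) {Z : Set X} (hZ : Z ∈ 𝒵) :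
    Q (Z \ ⋃₀ 𝓝) := by
  induction 𝓝, hfin using Set.Finite.induction_on generalizing Z with
  | empty => simpa using hbasic Z hZ
  | @insert N 𝓝 _ _ ih =>
    have h' : ∀ Z ∈ 𝒵, ∀ N ∈ 𝓝, Z ∩ N ∈ 𝒵 := fun Z hZ N hN =>
      h𝒵 Z hZ N (Set.mem_insert_of_mem _ hN)
    convert! hdiff _ _ ?_ (ih h' (h𝒵 Z hZ N (Set.mem_insert _ _))) (ih h' hZ) using 1
    · ext x
      simp only [Set.sUnion_insert, Set.mem_sdiff, Set.mem_union, Set.mem_inter_iff]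
      tauto
    · exact Set.sdiff_subset_sdiff_left Set.inter_subset_left

end Decided

namespace AcyclicPairing

variable {M : Type*} [AcyclicPairing M] {α β : Type*}

/-! #### Constructible sets -/

/-- The constructible sets are the Boolean combinations of finitely many equations. -/
def IsConstructible (A : Set (α → M)) : Prop :=
  ∃ 𝓔 : Set (Set (α → M)), 𝓔.Finite ∧ (∀ E ∈ 𝓔, IsEquation E) ∧ IsDecided 𝓔 A

theorem IsClosedSet.isConstructible {Z : Set (α → M)} (hZ : IsClosedSet Z) :
    IsConstructible Z := by
  obtain ⟨𝓔, h1, h2, rfl⟩ := hZ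
  exact ⟨𝓔, h1, h2, fun x y hxy hx E hE => (hxy E hE).1 (hx E hE)⟩

theorem isConstructible_empty : IsConstructible (∅ : Set (α → M)) :=
  ⟨∅, Set.finite_empty, by simp, fun _ _ _ h => h⟩

theorem IsConstructible.compl {A : Set (α → M)} (hA : IsConstructible A) :
    IsConstructible Aᶜ := by
  obtain ⟨𝓔, h1, h2, h⟩ := hA
  exact ⟨𝓔, h1, h2, fun x y hxy hx hy => hx (h y x (fun E hE => (hxy E hE).symm) hy)⟩

theorem IsConstructible.union {A B : Set (α → M)} (hA : IsConstructible A)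
    (hB : IsConstructible B) : IsConstructible (A ∪ B) := by
  obtain ⟨𝓔, h1, h2, h⟩ := hA
  obtain ⟨𝓕, h3, h4, h'⟩ := hB
  refine ⟨𝓔 ∪ 𝓕, h1.union h3, ?_, fun x y hxy => Or.imp ?_ ?_⟩
  · rintro E (hE | hE)
    exacts [h2 E hE, h4 E hE]
  · exact h.mono Set.subset_union_left x y hxy
  · exact h'.mono Set.subset_union_right x y hxy

theorem IsConstructible.inter {A B : Set (α → M)} (hA : IsConstructible A)
    (hB : IsConstructible B) : IsConstructible (A ∩ B) := by
  rw [← compl_compl (A ∩ B), Set.compl_inter]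
  exact (hA.compl.union hB.compl).compl

theorem isConstructible_biInter {ι : Type*} {I : Set ι} (hI : I.Finite) {A : ι → Set (α → M)}
    (h : ∀ i ∈ I, IsConstructible (A i)) : IsConstructible (⋂ i ∈ I, A i) := by
  induction I, hI using Set.Finite.induction_on with
  | empty => simpa using isClosedSet_univ.isConstructible
  | insert _ _ ih =>
    rw [Set.biInter_insert]
    exact (h _ (Set.mem_insert _ _)).inter (ih fun i hi => h i (Set.mem_insert_of_mem _ hi))

/-- Constructible sets satisfy an induction principle: it is enough to consider disjoint unions,
and differences of a closed set and a finite union of closed sets. -/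
theorem IsConstructible.induction {Q : Set (α → M) → Prop} (hempty : Q ∅)
    (hunion : ∀ A B, Disjoint A B → Q A → Q B → Q (A ∪ B))
    (hdiff : ∀ Z, IsClosedSet Z → ∀ 𝓝 : Set (Set (α → M)), 𝓝.Finite →
      (∀ N ∈ 𝓝, IsClosedSet N) → Q (Z \ ⋃₀ 𝓝)) {A : Set (α → M)} (hA : IsConstructible A) :
    Q A := by
  obtain ⟨𝓔, h1, h2, h⟩ := hA
  have := h.induction h1 (𝒵 := {Z | IsClosedSet Z}) (Q := Q)
    (fun Z hZ E hE => IsClosedSet.inter hZ (h2 E hE).isClosedSet) hempty hunion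
    (fun Z hZ 𝓝 h𝓝 => hdiff Z hZ 𝓝 (h1.subset h𝓝) fun N hN => (h2 N (h𝓝 hN)).isClosedSet)
    (isClosedSet_univ : (Set.univ : Set (α → M)) ∈ {Z | IsClosedSet Z})
  rwa [Set.univ_inter] at this

-- The quantifier elimination step. A point with parameters `u` is in the image when its fibre, the
-- coordinate subspace through `u` in the unseen directions `K`, is not covered by the preimages of
-- `𝓝`. By `exists_forall_notMem` this means that no single preimage contains it, which is the
-- complement of a closed condition on `u`; `ψ` transports it to the image.
open PairTerm in
theorem IsClosedSet.isConstructible_image_sdiff [Nonempty M] [Finite α] [Finite β]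
    {Z : Set (β → M)} (hZ : IsClosedSet Z) {𝓝 : Set (Set (β → M))} (hfin : 𝓝.Finite)
    (h𝓝 : ∀ N ∈ 𝓝, IsClosedSet N) (ρ : α → β) :
    IsConstructible ((fun (x : β → M) i => x (ρ i)) '' (Z \ ⋃₀ 𝓝)) := by
  classical
  obtain rfl | hne := Z.eq_empty_or_nonempty
  · simpa using isConstructible_empty
  obtain ⟨m, φ, -, rfl⟩ := hZ.exists_param hne
  obtain ⟨ψ, hreg, hψ⟩ := exists_recover fun i => φ (ρ i)
  let K : Finset (Fin m) := Finset.univ.filter fun j => ¬ ∃ i, (φ (ρ i)).Occurs j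
  have hK : ∀ j, j ∉ K ↔ ∃ i, (φ (ρ i)).Occurs j := fun j => by simp [K]
  let G : Set (β → M) → Set (Fin m → M) := fun N =>
    {u | ∀ v, (∀ j ∉ K, v j = u j) → v ∈ evalMap φ ⁻¹' N}
  have hG : ∀ N ∈ 𝓝, IsClosedSet (ψ ⁻¹' G N) := fun N hN =>
    (((h𝓝 N hN).preimage (isRegular_evalMap φ)).isClosedSet_forall K).preimage hreg
  have himg : (fun (x : β → M) i => x (ρ i)) '' (Set.range (evalMap φ) \ ⋃₀ 𝓝) =
      Set.range (evalMap fun i => φ (ρ i)) ∩ ⋂ N ∈ 𝓝, (ψ ⁻¹' G N)ᶜ := by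
    ext x
    simp only [Set.mem_inter_iff, Set.mem_iInter]
    constructor
    · rintro ⟨_, ⟨⟨u, rfl⟩, hu⟩, rfl⟩
      refine ⟨⟨u, rfl⟩, fun N hN hmem => hu ⟨N, hN, hmem u fun j hj => ?_⟩⟩
      exact (hψ u j ((hK j).1 hj)).symm
    · rintro ⟨⟨u, rfl⟩, hu⟩
      obtain ⟨v, hv, hv'⟩ := exists_forall_notMem K (𝓖 := (evalMap φ ⁻¹' ·) '' 𝓝) (hfin.image _)
        (by
          rintro _ ⟨N, hN, rfl⟩
          exact ((h𝓝 N hN).preimage (isRegular_evalMap φ)).lineIrreducible) u (by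
          rintro _ ⟨N, hN, rfl⟩
          have := hu N hN
          simp only [G, Set.mem_compl_iff, Set.mem_preimage, Set.mem_ofPred_eq, not_forall] at this
          obtain ⟨v, hv, hvN⟩ := this
          exact ⟨v, fun j hj => (hv j hj).trans (hψ u j ((hK j).1 hj)), hvN⟩)
      refine ⟨evalMap φ v, ⟨⟨v, rfl⟩, ?_⟩, ?_⟩
      · rintro ⟨N, hN, hmem⟩
        exact hv' _ ⟨N, hN, rfl⟩ hmem
      · exact evalMap_congr (φ := fun i => φ (ρ i)) fun j hj => hv j ((hK j).2 hj)
  rw [himg]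
  exact (isClosedSet_range_evalMap _).isConstructible.inter
    (isConstructible_biInter hfin fun N hN => (hG N hN).isConstructible.compl)

/-- Coordinate projections of constructible sets are constructible. -/
theorem IsConstructible.image [Nonempty M] [Finite α] [Finite β] {A : Set (β → M)}
    (hA : IsConstructible A) (ρ : α → β) :
    IsConstructible ((fun (x : β → M) i => x (ρ i)) '' A) := by
  refine hA.induction (Q := fun A => IsConstructible ((fun (x : β → M) i => x (ρ i)) '' A))
    ?_ ?_ ?_
  · simpa using isConstructible_empty
  · intro A B _ hA hB
    rw [Set.image_union]
    exact hA.union hB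
  · exact fun Z hZ 𝓝 hfin h𝓝 => hZ.isConstructible_image_sdiff hfin h𝓝 ρ

/-! #### Euler characteristics -/

open PairTerm in
/-- The indicator functions of the nonempty closed sets are linearly independent. -/
theorem linearIndependent_indicator [Nonempty M] [Finite α] :
    LinearIndependent ℚ fun Z : {Z : Set (α → M) // IsClosedSet Z ∧ Z.Nonempty} =>
      Set.indicator Z.1 (1 : (α → M) → ℚ) := by
  classical
  rw [linearIndependent_iff']
  intro s c hc
  by_contra! h
  obtain ⟨Z₀, hZ₀, hcZ₀⟩ := h
  -- A maximal `Z` with nonzero coefficient is contained in none of the others, so by irreducibility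
  -- it has a point outside them all. Evaluation there isolates its coefficient.
  obtain ⟨Z, hZ⟩ := (s.filter fun Z => c Z ≠ 0).exists_maximal
    ⟨Z₀, Finset.mem_filter.2 ⟨hZ₀, hcZ₀⟩⟩
  obtain ⟨hZs, hcZ⟩ := Finset.mem_filter.1 hZ.1
  obtain ⟨x, hxZ, hx⟩ := Z.2.1.exists_mem_forall_notMem Z.2.2
    (𝓖 := Subtype.val '' {Y | Y ∈ (s.filter fun Y => c Y ≠ 0).erase Z})
    ((Finset.finite_toSet _).image _) (by
      rintro _ ⟨Y, hY, rfl⟩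
      obtain ⟨hne, hY⟩ := Finset.mem_erase.1 hY
      exact ⟨Y.2.1, fun hsub => hne (le_antisymm (hZ.2 hY hsub) hsub)⟩)
  have hval := congrFun hc x
  rw [Finset.sum_apply, Finset.sum_eq_single Z] at hval
  · exact hcZ (by simpa [hxZ] using hval)
  · intro Y hY hne
    by_cases hcY : c Y = 0
    · simp [hcY]
    · have : x ∉ Y.1 := hx _ ⟨Y, by simp [hne, hY, hcY], rfl⟩
      simp [this]
  · exact fun h => (h hZs).elim

open Classical in
/-- The value of the Euler characteristic on a nonempty closed set. -/
noncomputable def weight (Z : Set (α → M)) : ℚ × ℚ := if Z.Subsingleton then (1, 0) else (0, 1)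

/-- Linear independence allows the values to be prescribed. Working over a field lets the map extend
to all functions, so additivity on sets is automatic. -/
theorem exists_euler [Nonempty M] [Finite α] :
    ∃ χ : ((α → M) → ℚ) →ₗ[ℚ] ℚ × ℚ, ∀ Z : Set (α → M), IsClosedSet Z → Z.Nonempty →
      χ (Z.indicator 1) = weight Z := by
  have hli := linearIndependent_indicator (M := M) (α := α)
  obtain ⟨χ, hχ⟩ := ((Module.Basis.span hli).constr ℚ fun Z => weight Z.1).exists_extend
  refine ⟨χ, fun Z hZ hne => ?_⟩
  have h1 := (Module.Basis.span hli).constr_basis ℚ (fun Z => weight Z.1) ⟨Z, hZ, hne⟩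
  rw [← hχ, LinearMap.comp_apply, Submodule.subtype_apply, Module.Basis.span_apply] at h1
  exact h1

/-- The Euler characteristic of a set, with values `(1, 0)` at points and `(0, 1)` at powers of
`M`. -/
noncomputable def euler [Nonempty M] [Finite α] (A : Set (α → M)) : ℚ × ℚ :=
  (exists_euler (M := M) (α := α)).choose (A.indicator 1)

section Euler

variable [Nonempty M] [Finite α] [Finite β]

theorem IsClosedSet.euler_eq {Z : Set (α → M)} (hZ : IsClosedSet Z) (hne : Z.Nonempty) :
    euler Z = weight Z :=
  (exists_euler (M := M) (α := α)).choose_spec Z hZ hne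

theorem euler_empty : euler (∅ : Set (α → M)) = 0 := by
  rw [euler, Set.indicator_empty]
  exact map_zero _

theorem euler_union {A B : Set (α → M)} (h : Disjoint A B) :
    euler (A ∪ B) = euler A + euler B := by
  rw [euler, euler, euler, ← map_add, Set.indicator_union_of_disjoint h]
  rfl

theorem euler_sdiff {A B : Set (α → M)} (h : A ⊆ B) : euler (B \ A) = euler B - euler A := by
  rw [eq_sub_iff_add_eq, ← euler_union Set.disjoint_sdiff_left, Set.sdiff_union_of_subset h]

-- The image is again the range of a term map, hence closed, and an injective map preserves being a
-- single point.
open PairTerm in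
theorem IsClosedSet.euler_image {Z : Set (β → M)} (hZ : IsClosedSet Z) {ρ : α → β}
    (hinj : Set.InjOn (fun x i => x (ρ i)) Z) :
    euler ((fun x i => x (ρ i)) '' Z) = euler Z := by
  obtain rfl | hne := Z.eq_empty_or_nonempty
  · rw [Set.image_empty, euler_empty, euler_empty]
  have hclosed : IsClosedSet ((fun x i => x (ρ i)) '' Z) := by
    obtain ⟨m, φ, -, rfl⟩ := hZ.exists_param hne
    rw [← Set.range_comp]
    exact isClosedSet_range_evalMap fun i => φ (ρ i)
  rw [hclosed.euler_eq (hne.image _), hZ.euler_eq hne, weight, weight]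
  congr 1
  rw [eq_iff_iff]
  exact ⟨fun h x hx y hy => hinj hx hy (h ⟨x, hx, rfl⟩ ⟨y, hy, rfl⟩), fun h => h.image _⟩

/-- The Euler characteristic is invariant under injective coordinate projections. -/
theorem IsConstructible.euler_image {A : Set (β → M)} (hA : IsConstructible A) {ρ : α → β}
    (hinj : Set.InjOn (fun x i => x (ρ i)) A) :
    euler ((fun x i => x (ρ i)) '' A) = euler A := by
  refine hA.induction (Q := fun A => Set.InjOn (fun (x : β → M) i => x (ρ i)) A →
    euler ((fun (x : β → M) i => x (ρ i)) '' A) = euler A) ?_ ?_ ?_ hinj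
  · intro _
    rw [Set.image_empty, euler_empty, euler_empty]
  · intro A B hAB hA hB hinj
    rw [Set.image_union, euler_union hAB, euler_union, hA (hinj.mono Set.subset_union_left),
      hB (hinj.mono Set.subset_union_right)]
    rw [Set.disjoint_iff_inter_eq_empty, ← hinj.image_inter Set.subset_union_left
      Set.subset_union_right, hAB.inter_eq, Set.image_empty]
  · intro Z hZ 𝓝 hfin h𝓝 hinj
    obtain h | hne := (Z \ ⋃₀ 𝓝).eq_empty_or_nonempty
    · rw [h, Set.image_empty, euler_empty, euler_empty]
    -- Injectivity on all of `Z` is what allows the closed pieces of `Z` to be projected separately.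
    have hinj := hZ.injOn_of_injOn_diff hfin h𝓝 hne hinj
    refine (sdiff_sUnion_induction hfin (𝒵 := {Y | IsClosedSet Y ∧ Y ⊆ Z})
      (Q := fun A => A ⊆ Z ∧ euler ((fun (x : β → M) i => x (ρ i)) '' A) = euler A)
      ?_ ?_ ?_ ⟨hZ, subset_rfl⟩).2
    · exact fun Y hY N hN => ⟨hY.1.inter (h𝓝 N hN), Set.inter_subset_left.trans hY.2⟩
    · exact fun Y hY => ⟨hY.2, hY.1.euler_image (hinj.mono hY.2)⟩
    · rintro A B hAB ⟨-, hA⟩ ⟨hBZ, hB⟩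
      refine ⟨Set.sdiff_subset.trans hBZ, ?_⟩
      rw [(hinj.mono hBZ).image_sdiff_subset hAB, euler_sdiff (Set.image_mono hAB), euler_sdiff hAB,
        hA, hB]

end Euler

end AcyclicPairing

/-! ### Rings generated by an idempotent -/

section Idempotent

open Polynomial

/-- Modulo `X - X ^ 2` all positive powers of `X` agree with `X`. -/
theorem exists_sub_mem_span_X_sub_X_sq (p : ℤ[X]) :
    ∃ a b : ℤ, p - (C a + C b * X) ∈ Ideal.span {(X - X ^ 2 : ℤ[X])} := by
  induction p using Polynomial.induction_on' with
  | add p q hp hq =>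
    obtain ⟨a, b, h⟩ := hp
    obtain ⟨a', b', h'⟩ := hq
    refine ⟨a + a', b + b', ?_⟩
    convert! Ideal.add_mem _ h h' using 1
    simp only [map_add]
    ring
  | monomial n c =>
    obtain _ | n := n
    · exact ⟨c, 0, by simp⟩
    · refine ⟨0, c, ?_⟩
      rw [← C_mul_X_pow_eq_monomial, map_zero, zero_add]
      induction n with
      | zero => simp
      | succ n ih =>
        convert! Ideal.sub_mem _ ih (Ideal.mul_mem_left _ (C c * X ^ n)
          (Ideal.mem_span_singleton_self (X - X ^ 2 : ℤ[X]))) using 1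
        ring

variable {R : Type*} [CommRing R] {x : R}

/-- A ring that is freely generated as an additive group by `1` and an idempotent is isomorphic to
`ℤ[X] / (X - X ^ 2)`. -/
theorem exists_quotient_X_sub_X_sq_equiv (hx : x * x = x)
    (hind : ∀ a b : ℤ, (a : R) + b * x = 0 → a = 0 ∧ b = 0)
    (hgen : ∀ y : R, ∃ a b : ℤ, y = a + b * x) :
    ∃ e : (ℤ[X] ⧸ Ideal.span {(X - X ^ 2 : ℤ[X])}) ≃+* R,
      e.toRingHom.comp (Ideal.Quotient.mk _) = eval₂RingHom (Int.castRingHom R) x := by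
  let f : ℤ[X] →+* R := eval₂RingHom (Int.castRingHom R) x
  have hf : ∀ a b : ℤ, f (C a + C b * X) = a + b * x := fun a b => by
    simp only [f, coe_eval₂RingHom, eval₂_add, eval₂_mul, eval₂_C, eval₂_X]
    rfl
  have hsurj : Function.Surjective f := fun y => by
    obtain ⟨a, b, rfl⟩ := hgen y
    exact ⟨_, hf a b⟩
  have hle : Ideal.span {(X - X ^ 2 : ℤ[X])} ≤ RingHom.ker f := by
    rw [Ideal.span_singleton_le_iff_mem, RingHom.mem_ker]
    simp [f, sq, hx]
  have hker : Ideal.span {(X - X ^ 2 : ℤ[X])} = RingHom.ker f := by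
    refine le_antisymm hle fun p hp => ?_
    obtain ⟨a, b, h⟩ := exists_sub_mem_span_X_sub_X_sq p
    have h0 := hle h
    rw [RingHom.mem_ker, map_sub, RingHom.mem_ker.1 hp, hf, zero_sub, neg_eq_zero] at h0
    obtain ⟨rfl, rfl⟩ := hind a b h0
    simpa using h
  refine ⟨(Ideal.quotEquivOfEq hker).trans (RingHom.quotientKerEquivOfSurjective hsurj), ?_⟩
  ext p <;> simp [f]

end Idempotent

/-! ### Definable sets in models of the theory of pairing functions without cycles -/

namespace FirstOrder.Language.DefClass

theorem mk_power_succ (L : Language) (M : Type*) [L.Structure M] (m : ℕ) :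
    mk (DefSet.power L M (m + 1)) = mk (DefSet.power L M m) * mk (DefSet.power L M 1) := by
  rw [← mk_prod]
  congr 1
  simp only [DefSet.power, DefSet.prod, DefSet.mk.injEq, heq_eq_eq, true_and]
  exact (Set.eq_univ_of_forall fun p => And.intro trivial trivial).symm

end FirstOrder.Language.DefClass

namespace FirstOrder.Language.pairing

open AcyclicPairing

variable (M : Type*) [pairing.Structure M] [M ⊨ theoryWithoutCycles]

noncomputable instance : AcyclicPairing M where
  step b x := Structure.funMap (cond b r l) ![x]
  pair x y := (Equiv.ofBijective _ ((model_iff M).1 inferInstance).1).symm (x, y)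
  step_false_pair x y := congrArg Prod.fst
    ((Equiv.ofBijective _ ((model_iff M).1 inferInstance).1).apply_symm_apply (x, y))
  step_true_pair x y := congrArg Prod.snd
    ((Equiv.ofBijective _ ((model_iff M).1 inferInstance).1).apply_symm_apply (x, y))
  pair_step x := (Equiv.ofBijective _ ((model_iff M).1 inferInstance).1).symm_apply_apply x
  foldl_ne w hw x := by
    -- Words here apply their first letter first, while the axioms apply it last; hence the
    -- reversal.
    have := ((model_iff M).1 inferInstance).2 (w.map fun b => cond b r l).reverse (by simpa) x
    rwa [List.foldr_reverse, List.foldl_map] at this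

variable {M} {γ : Type} {n : ℕ}

/-! #### Closed sets are definable, and their classes -/

theorem exists_term_of_isAtom {f : (γ → M) → M} (hf : IsAtom f) :
    ∃ t : (pairing[[(Set.univ : Set M)]]).Term γ, ∀ v, t.realize v = f v := by
  cases hf with
  | word w i =>
    suffices h : ∀ t : (pairing[[(Set.univ : Set M)]]).Term γ,
        ∃ t' : (pairing[[(Set.univ : Set M)]]).Term γ,
          ∀ v : γ → M, t'.realize v = word w (t.realize v) from h (.var i)
    induction w with
    | nil => exact fun t => ⟨t, fun _ => rfl⟩
    | cons b w ih =>
      intro t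
      obtain ⟨t', ht'⟩ := ih (Functions.apply₁
        ((pairing.lhomWithConstants (Set.univ : Set M)).onFunction (cond b r l)) t)
      refine ⟨t', fun v => (ht' v).trans ?_⟩
      rw [Term.realize_functions_apply₁, LHom.map_onFunction]
      rfl
  | const c => exact ⟨(pairing.con (⟨c, trivial⟩ : ↑(Set.univ : Set M))).term, fun v => by simp⟩

theorem definable_of_isClosedSet {Z : Set (γ → M)} (hZ : IsClosedSet Z) :
    (Set.univ : Set M).Definable pairing Z := by
  obtain ⟨𝓔, h1, h2, rfl⟩ := hZ
  induction 𝓔, h1 using Set.Finite.induction_on with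
  | empty =>
    rw [Set.sInter_empty]
    exact Set.definable_univ
  | @insert E 𝓔 _ _ ih =>
    rw [Set.sInter_insert]
    refine Set.Definable.inter ?_ (ih fun F hF => h2 F (Set.mem_insert_of_mem _ hF))
    obtain ⟨f, g, hf, hg, rfl⟩ := h2 E (Set.mem_insert _ _)
    obtain ⟨s, hs⟩ := exists_term_of_isAtom hf
    obtain ⟨t, ht⟩ := exists_term_of_isAtom hg
    exact ⟨s.equal t, by ext; simp [hs, ht]⟩

-- The graph of a term map is closed, so the parametrization is a definable bijection.
open PairTerm in
theorem mk_eq_mk_power_of_param {m : ℕ} {Z : Set (Fin n → M)}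
    (hZ : (Set.univ : Set M).Definable pairing Z) {φ : Fin n → PairTerm M m}
    (hφ : Function.Injective (evalMap φ)) (hr : Set.range (evalMap φ) = Z) :
    DefClass.mk ⟨n, Z, hZ⟩ = DefClass.mk (DefSet.power pairing M m) := by
  subst hr
  rw [eq_comm, DefClass.mk_eq_mk]
  refine ⟨(Equiv.Set.univ _).trans (Equiv.ofInjective _ hφ), ?_⟩
  have h := definable_of_isClosedSet (isClosedSet_iInter fun i : Fin n =>
    ((isRegular_evalMap φ i).comp fun j : Fin m =>
      IsRegular.coord (α := Fin m ⊕ Fin n) (Sum.inl j)).isClosedSet_eq (.coord (Sum.inr i)))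
  refine (congrArg (Set.Definable _ pairing) (Set.ext fun p => ?_)).mp h
  refine Set.mem_iInter.trans ⟨?_, ?_⟩
  · exact fun h => ⟨⟨_, trivial⟩, rfl, funext fun i => (h i).symm⟩
  · rintro ⟨x, hx, hy⟩ i
    exact (congrArg (fun u => evalMap φ u i) hx).trans (congrFun hy i).symm

/-- The definable bijection is `pair` itself, from `M ^ 2` to `M`. -/
theorem mk_line_mul_mk_line : DefClass.mk (DefSet.power pairing M 1) *
    DefClass.mk (DefSet.power pairing M 1) = DefClass.mk (DefSet.power pairing M 1) := by
  rw [← DefClass.mk_power_succ, eq_comm]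
  refine mk_eq_mk_power_of_param Set.definable_univ
    (φ := fun _ => .pair (.var 0) (.var 1)) (fun u v huv => ?_) (Set.eq_univ_of_forall fun x => ?_)
  · have := congrFun huv 0
    simp only [PairTerm.evalMap, PairTerm.eval, eq_pair_iff, step_false_pair, step_true_pair] at this
    funext i
    fin_cases i
    exacts [this.1, this.2]
  · refine ⟨![step false (x 0), step true (x 0)], funext fun i => ?_⟩
    simp [PairTerm.evalMap, PairTerm.eval, Subsingleton.elim i 0]

variable [Nonempty M]

/-! #### Definable sets are constructible -/

theorem isRegular_realize (t : (pairing[[(Set.univ : Set M)]]).Term γ) :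
    IsRegular fun v : γ → M => t.realize v := by
  induction t with
  | var i => exact .coord i
  | @func n f ts ih =>
    rcases f with f | c
    · cases f with
      | l =>
        convert! (ih 0).step false using 2 with v
        exact congrArg _ (funext fun i => by rw [Subsingleton.elim i 0]; rfl)
      | r =>
        convert! (ih 0).step true using 2 with v
        exact congrArg _ (funext fun i => by rw [Subsingleton.elim i 0]; rfl)
    · obtain _ | n := n
      · convert! IsRegular.const (α := γ) ((Term.func (Sum.inr c) ts).realize fun _ =>
          Classical.arbitrary M) using 2 with v
      · exact PEmpty.elim (by cases n <;> exact c)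

theorem isConstructible_realize [Finite γ]
    (φ : (pairing[[(Set.univ : Set M)]]).BoundedFormula γ n) :
    IsConstructible {x : γ ⊕ Fin n → M | φ.Realize (x ∘ Sum.inl) (x ∘ Sum.inr)} := by
  induction φ with
  | falsum => exact isConstructible_empty
  | equal s t =>
    convert! ((isRegular_realize s).isClosedSet_eq (isRegular_realize t)).isConstructible using 1
    ext x
    change _ = _ ↔ _ = _
    rw [Sum.elim_comp_inl_inr]
  | rel R ts => rcases R with R | R <;> cases R
  | imp φ ψ h₁ h₂ =>
    convert! h₁.compl.union h₂ using 1
    ext x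
    simp [imp_iff_not_or]
  | @all n φ h =>
    -- A universal quantifier is the complement of a projection of the complement.
    convert! (h.compl.image (Sum.map id Fin.castSucc : γ ⊕ Fin n → γ ⊕ Fin (n + 1))).compl using 1
    ext x
    simp only [BoundedFormula.realize_all, Set.mem_ofPred_eq, Set.mem_compl_iff, Set.mem_image,
      not_exists, not_and, not_imp_not]
    constructor
    · rintro hx y hyx
      subst hyx
      convert! hx (y (Sum.inr (Fin.last n))) using 1
      funext i
      refine Fin.lastCases ?_ (fun i => ?_) i <;> simp
    · intro hx a
      have := hx (Sum.elim (x ∘ Sum.inl) (Fin.snoc (x ∘ Sum.inr) a)) (by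
        funext i
        rcases i with i | i <;> simp)
      simpa using! this

theorem isConstructible_of_definable [Finite γ] {A : Set (γ → M)}
    (hA : (Set.univ : Set M).Definable pairing A) : IsConstructible A := by
  obtain ⟨φ, rfl⟩ := hA
  convert! (isConstructible_realize φ).image (Sum.inl : γ → γ ⊕ Fin 0) using 1
  ext v
  constructor
  · intro hv
    refine ⟨Sum.elim v default, ?_, rfl⟩
    simpa [Formula.Realize] using! hv
  · rintro ⟨x, hx, rfl⟩
    rw [Set.mem_ofPred_eq, Subsingleton.elim (x ∘ Sum.inr) default] at hx
    exact hx

/-! #### The Euler characteristic of a definable set -/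

/-- The graph of a definable bijection projects injectively onto both its source and its target. -/
theorem euler_eq_of_equivalent {A B : DefSet pairing M} (h : A.Equivalent B) :
    euler A.carrier = euler B.carrier := by
  obtain ⟨f, hf⟩ := h
  have hΓ := isConstructible_of_definable hf
  have h1 := hΓ.euler_image (ρ := Sum.inl) (by
    rintro p ⟨x, hx, hx'⟩ q ⟨y, hy, hy'⟩ hpq
    obtain rfl : x = y := Subtype.ext (hx.symm.trans (Eq.trans hpq hy))
    rw [← Sum.elim_comp_inl_inr p, ← Sum.elim_comp_inl_inr q, hx, hx', hy, hy'])
  have h2 := hΓ.euler_image (ρ := Sum.inr) (by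
    rintro p ⟨x, hx, hx'⟩ q ⟨y, hy, hy'⟩ hpq
    obtain rfl : x = y := f.injective (Subtype.ext (hx'.symm.trans (Eq.trans hpq hy')))
    rw [← Sum.elim_comp_inl_inr p, ← Sum.elim_comp_inl_inr q, hx, hx', hy, hy'])
  convert! h1.trans h2.symm using 2
  · ext x
    constructor
    · exact fun hx => ⟨Sum.elim x (f ⟨x, hx⟩).1, ⟨⟨x, hx⟩, rfl, rfl⟩, rfl⟩
    · rintro ⟨p, ⟨y, hy, -⟩, rfl⟩
      exact Set.mem_of_eq_of_mem hy y.2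
  · ext x
    constructor
    · exact fun hx => ⟨Sum.elim (f.symm ⟨x, hx⟩).1 x, ⟨f.symm ⟨x, hx⟩, rfl, by simp⟩, rfl⟩
    · rintro ⟨p, ⟨y, -, hy⟩, rfl⟩
      exact Set.mem_of_eq_of_mem hy (f y).2

/-- The two tagged pieces are disjoint, and forgetting the constant coordinates projects them
injectively onto `A` and `B`. -/
theorem euler_sum (A B : DefSet pairing M) :
    euler (A.sum B).carrier = euler A.carrier + euler B.carrier := by
  let S : Set (Fin (A.dim + B.dim + 1) → M) :=
      {p : Fin (A.dim + B.dim + 1) → M | p (Fin.last _) = DefSet.tag M false ∧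
        (fun i : Fin A.dim => p (Fin.castSucc (Fin.castAdd B.dim i))) ∈ A.carrier ∧
        ∀ j : Fin B.dim, p (Fin.castSucc (Fin.natAdd A.dim j)) = DefSet.tag M false}
  have hS : (Set.univ : Set M).Definable pairing S :=
    (DefSet.definable_eq_const _ _).inter <| (A.definable.preimage_comp _).inter <|
      DefSet.definable_forall fun _ => DefSet.definable_eq_const _ _
  let T : Set (Fin (A.dim + B.dim + 1) → M) :=
      {p : Fin (A.dim + B.dim + 1) → M | p (Fin.last _) = DefSet.tag M true ∧
        (fun j : Fin B.dim => p (Fin.castSucc (Fin.natAdd A.dim j))) ∈ B.carrier ∧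
        ∀ i : Fin A.dim, p (Fin.castSucc (Fin.castAdd B.dim i)) = DefSet.tag M false}
  have hT : (Set.univ : Set M).Definable pairing T :=
    (DefSet.definable_eq_const _ _).inter <| (B.definable.preimage_comp _).inter <|
      DefSet.definable_forall fun _ => DefSet.definable_eq_const _ _
  have h1 := (isConstructible_of_definable hS).euler_image
    (ρ := fun i : Fin A.dim => Fin.castSucc (Fin.castAdd B.dim i)) (by
      rintro p ⟨hp, -, hp'⟩ q ⟨hq, -, hq'⟩ hpq
      funext i
      refine Fin.lastCases ?_ (fun i => Fin.addCases (fun i => ?_) (fun i => ?_) i) i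
      exacts [hp.trans hq.symm, congrFun hpq i, (hp' i).trans (hq' i).symm])
  have h2 := (isConstructible_of_definable hT).euler_image
    (ρ := fun i : Fin B.dim => Fin.castSucc (Fin.natAdd A.dim i)) (by
      rintro p ⟨hp, -, hp'⟩ q ⟨hq, -, hq'⟩ hpq
      funext i
      refine Fin.lastCases ?_ (fun i => Fin.addCases (fun i => ?_) (fun i => ?_) i) i
      exacts [hp.trans hq.symm, (hp' i).trans (hq' i).symm, congrFun hpq i])
  have h3 : (fun (x : Fin (A.dim + B.dim + 1) → M) (i : Fin A.dim) =>
      x (Fin.castSucc (Fin.castAdd B.dim i))) '' S = A.carrier := by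
    refine Set.Subset.antisymm (by rintro _ ⟨p, hp, rfl⟩; exact hp.2.1) ?_
    exact fun x hx => ⟨(DefSet.inl A B ⟨x, hx⟩).1,
      by simp [S, DefSet.inl, -Fin.castSucc_natAdd, hx], by simp [DefSet.inl]⟩
  have h4 : (fun (x : Fin (A.dim + B.dim + 1) → M) (i : Fin B.dim) =>
      x (Fin.castSucc (Fin.natAdd A.dim i))) '' T = B.carrier := by
    refine Set.Subset.antisymm (by rintro _ ⟨p, hp, rfl⟩; exact hp.2.1) ?_
    exact fun x hx => ⟨(DefSet.inr A B ⟨x, hx⟩).1,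
      by simp [T, DefSet.inr, -Fin.castSucc_natAdd, hx], by simp [DefSet.inr, -Fin.castSucc_natAdd]⟩
  rw [← h3, ← h4, h1, h2, ← euler_union]
  · rfl
  · rw [Set.disjoint_left]
    exact fun p hp hp' => DefSet.tag_ne (hp.1.symm.trans hp'.1)

variable (M) in
/-- The Euler characteristic as an additive map on the Grothendieck ring. -/
noncomputable def eulerHom : K0 pairing M →+ ℚ × ℚ :=
  GrothendieckRing.liftAdd
    { toFun := Quotient.lift (fun A => euler A.carrier) fun _ _ => euler_eq_of_equivalent
      map_zero' := euler_empty
      map_add' := DefClass.ind fun A => DefClass.ind fun B => euler_sum A B }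

theorem eulerHom_mk (A : DefSet pairing M) : eulerHom M (K0.mk A) = euler A.carrier :=
  GrothendieckRing.liftAdd_ofAdd _ _

theorem eulerHom_one : eulerHom M 1 = (1, 0) := by
  refine (eulerHom_mk (DefSet.power pairing M 0)).trans ?_
  change euler (Set.univ : Set (Fin 0 → M)) = _
  rw [isClosedSet_univ.euler_eq Set.univ_nonempty, weight, if_pos Set.subsingleton_of_subsingleton]

theorem eulerHom_line : eulerHom M (K0.mk (DefSet.power pairing M 1)) = (0, 1) := by
  rw [eulerHom_mk]
  change euler (Set.univ : Set (Fin 1 → M)) = _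
  rw [isClosedSet_univ.euler_eq Set.univ_nonempty, weight, if_neg]
  rw [Set.not_subsingleton_iff]
  exact Set.nontrivial_univ

/-! #### The classes of definable sets -/

theorem mk_power (m : ℕ) : DefClass.mk (DefSet.power pairing M m) = 1 ∨
    DefClass.mk (DefSet.power pairing M m) = DefClass.mk (DefSet.power pairing M 1) := by
  induction m with
  | zero => exact Or.inl rfl
  | succ m ih =>
    right
    rcases ih with h | h
    · rw [DefClass.mk_power_succ, h, one_mul]
    · rw [DefClass.mk_power_succ, h, mk_line_mul_mk_line]

/-- Closed sets have class `0`, `1` or `[M]`, and the form `a + b[M]` survives disjoint unions and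
nested differences. -/
theorem K0_mk_eq (A : DefSet pairing M) : ∃ a b : ℤ,
    K0.mk A = a + b * K0.mk (DefSet.power pairing M 1) := by
  obtain ⟨n, A, hA⟩ := A
  set x := K0.mk (DefSet.power pairing M 1)
  let Q : Set (Fin n → M) → Prop := fun A => ∃ (h : (Set.univ : Set M).Definable pairing A)
    (a b : ℤ), K0.mk ⟨n, A, h⟩ = a + b * x
  have hmk : ∀ {A B : Set (Fin n → M)} (hA : (Set.univ : Set M).Definable pairing A)
      (hB : (Set.univ : Set M).Definable pairing B), Disjoint A B →
      K0.mk ⟨n, A ∪ B, hA.union hB⟩ = K0.mk ⟨n, A, hA⟩ + K0.mk ⟨n, B, hB⟩ := fun hA hB h => by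
    rw [K0.mk, DefClass.mk_union_of_disjoint hA hB h, map_add]
    rfl
  have hclosed : ∀ Z, IsClosedSet Z → Q Z := by
    intro Z hZ
    refine ⟨definable_of_isClosedSet hZ, ?_⟩
    obtain rfl | hne := Z.eq_empty_or_nonempty
    · refine ⟨0, 0, ?_⟩
      -- The empty set is its own disjoint double, so its class satisfies `y = y + y` and vanishes.
      have := hmk Set.definable_empty Set.definable_empty (Set.disjoint_empty ∅)
      simp only [Set.union_empty] at this
      simpa using this
    · obtain ⟨m, φ, hφ, hr⟩ := hZ.exists_param hne
      rw [K0.mk, mk_eq_mk_power_of_param _ hφ hr]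
      rcases mk_power (M := M) m with h | h
      · exact ⟨1, 0, by simp [h]⟩
      · exact ⟨0, 1, by simp [h, x, K0.mk]⟩
  suffices h : Q A from h.2
  refine (isConstructible_of_definable hA).induction (hclosed ∅ ?_) ?_ ?_
  · exact isEquation_empty.isClosedSet
  · rintro A B hAB ⟨hA, a, b, h⟩ ⟨hB, a', b', h'⟩
    refine ⟨hA.union hB, a + a', b + b', ?_⟩
    rw [hmk hA hB hAB, h, h']
    push_cast
    ring
  · intro Z hZ 𝓝 hfin h𝓝
    refine sdiff_sUnion_induction (𝒵 := {Z | IsClosedSet Z}) hfin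
      (fun Z hZ N hN => IsClosedSet.inter hZ (h𝓝 N hN)) hclosed ?_ hZ
    rintro A B hAB ⟨hA, a, b, h⟩ ⟨hB, a', b', h'⟩
    refine ⟨hB.sdiff hA, a' - a, b' - b, ?_⟩
    have := hmk (hB.sdiff hA) hA Set.disjoint_sdiff_left
    simp only [Set.sdiff_union_of_subset hAB] at this
    rw [← sub_eq_iff_eq_add.2 this, h, h']
    push_cast
    ring

end FirstOrder.Language.pairing

/-! ### The isomorphisms -/

open FirstOrder.Language FirstOrder.Language.pairing in
theorem mainTheorem1 (M : Type*) [FirstOrder.Language.pairing.Structure M] [Nonempty M]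
    [M ⊨ FirstOrder.Language.pairing.theoryWithoutCycles] :
    (∃ e : (ℤ[X] ⧸ Ideal.span {(Polynomial.X - Polynomial.X ^ 2 : ℤ[X])}) ≃+*
        FirstOrder.Language.K0 FirstOrder.Language.pairing M,
      e.toRingHom.comp (Ideal.Quotient.mk _) =
        Polynomial.eval₂RingHom (Int.castRingHom _)
          (FirstOrder.Language.K0.mk
            (FirstOrder.Language.DefSet.power FirstOrder.Language.pairing M 1))) ∧
    Nonempty (FirstOrder.Language.K0 FirstOrder.Language.pairing M ≃+* ℤ × ℤ) := by
  have h1 : ∃ e : (ℤ[X] ⧸ Ideal.span {(Polynomial.X - Polynomial.X ^ 2 : ℤ[X])}) ≃+*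
      K0 FirstOrder.Language.pairing M, e.toRingHom.comp (Ideal.Quotient.mk _) =
        Polynomial.eval₂RingHom (Int.castRingHom _)
          (K0.mk (DefSet.power FirstOrder.Language.pairing M 1)) := by
    refine exists_quotient_X_sub_X_sq_equiv ?_ (fun a b hab => ?_) fun y => ?_
    · rw [K0.mk, ← map_mul, mk_line_mul_mk_line]
    -- `eulerHom` is only additive, so integer multiples are rewritten as `zsmul` before it is
    -- applied; it then yields `(a, b) = 0`.
    · have := congrArg (eulerHom M) hab
      rw [map_add, map_zero, ← zsmul_eq_mul, ← zsmul_one, map_zsmul, map_zsmul, eulerHom_one,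
        eulerHom_line] at this
      simpa using this
    · obtain ⟨u, v, rfl⟩ := GrothendieckRing.exists_sub y
      induction u using DefClass.ind with | _ A
      induction v using DefClass.ind with | _ B
      obtain ⟨a, b, h⟩ := K0_mk_eq A
      obtain ⟨a', b', h'⟩ := K0_mk_eq B
      refine ⟨a - a', b - b', ?_⟩
      change K0.mk A - K0.mk B = _
      rw [h, h']
      push_cast
      ring
  -- `ℤ × ℤ` is also freely generated by `1` and the idempotent `(0, 1)`.
  obtain ⟨e, -⟩ := exists_quotient_X_sub_X_sq_equiv (R := ℤ × ℤ) (x := (0, 1)) (by simp)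
    (fun a b hab => by
      have h : a = 0 ∧ a + b = 0 := by simpa [Prod.ext_iff] using hab
      omega)
    fun y => ⟨y.1, y.2 - y.1, by ext <;> simp⟩
  refine ⟨h1, ?_⟩
  obtain ⟨e', -⟩ := h1
  exact ⟨e'.symm.trans e⟩
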